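/- **Conventions.** Let $\Sigma$ be a compact connected Riemann surface, $p_1,\dots,p_n\in\Sigma$ distinct points and $\Sigma^*=\Sigma\setminus\{p_1,\dots,p_n\}$. A *multivalued locally univalent meromorphic function* $f$ on $\Sigma^*$ is a nonempty collection of germs (function elements), at points of $\Sigma^*$, of injective holomorphic maps to $\overline{\mathbb C}=\mathbb C\cup\{\infty\}$, such that every element can be continued analytically along every path in $\Sigma^*$ within the collection and any two elements are analytic continuations of each other along a path in $\Sigma^*$. It is *projective* if any two elements $\mathfrak h_1,\mathfrak h_2$ of $f$ at the same point satisfy $\mathfrak h_1=L\circ\mathfrak h_2$ for some $L\in \mathrm{PGL}(2,\mathbb C)$ (acting by fractional linear transformations). The *monodromy* of $f$ is the set of $L\in\mathrm{PGL}(2,\mathbb C)$ such that the continuation of some function element $\mathfrak h$ of $f$ along some loop in $\Sigma^*$ is $L\circ \mathfrak h$. For real $c$, $f$ has a *regular singularity of weight $c$* at $p_j$ if in some complex coordinate $z$ near $p_j$ with $z(p_j)=0$ its Schwarzian satisfies, near $z=0$, $$\{f,z\}=\frac{f'''}{f'}-\frac32\Bigl(\frac{f''}{f'}\Bigr)^2=\frac{c}{z^2}+\frac{d}{z}+\psi(z)$$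 with $d$ constant and $\psi$ holomorphic. Let $g_{\rm st}=\frac{4|dw|^2}{(1+|w|^2)^2}$ be the standard metric on $\overline{\mathbb C}$. A smooth conformal metric $g$ on $\Sigma^*$ *represents* the divisor $\sum_j(\alpha_j-1)P_j$ (where $\alpha_j>0$ and $P_j$ denotes the point $p_j$ viewed as a divisor) if for each $j$ there is a complex coordinate $z$ near $p_j$ with $z(p_j)=0$ in which $g=e^{2\varphi}|dz|^2$ and $\varphi-(\alpha_j-1)\ln|z|$ extends continuously to $z=0$. Let $\mathrm{PSU}(2)\subset\mathrm{PGL}(2,\mathbb C)$ be the image of $\mathrm{SU}(2)$. **Lemma 1.2.** Let $f$ be a projective multivalued locally univalent meromorphic function on $\Sigma^*$ whose monodromy is contained in a maximal compact subgroup of $\mathrm{PGL}(2,\mathbb C)$. Suppose that $f$ has, for every $j=1,\dots,n$, a regular singularity of weight $c_j$ at $p_j$, where $c_j$ is real and $0\ne c_j<1/2$. Then there are real numbers $\alpha_1,\dots,\alpha_n$ with $0<\alpha_j\neq1$ and $c_j=(1-\alpha_j^2)/2$ such that the following hold. 1. For each $j$ there are a neighborhood $U_j$ of $p_j$ with a complex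 coordinate $z$, $z(p_j)=0$, and $L_j\in\mathrm{PGL}(2,\mathbb C)$ such that $L_j\circ f$ has the form $z^{\alpha_j}$ on $U_j\setminus\{p_j\}$; that is, every branch of $z^{\alpha_j}$ at every point of $U_j\setminus\{p_j\}$ is $L_j\circ\mathfrak h$ for some function element $\mathfrak h$ of $f$. 2. There is $\mathfrak L\in\mathrm{PGL}(2,\mathbb C)$ such that the pullback $(\mathfrak L\circ f)^*g_{\rm st}$ is a well-defined conformal metric on $\Sigma^*$ (independent of the function elements used) of constant Gauss curvature $1$ which represents the divisor $\sum_j(\alpha_j-1)P_j$. 3. If the monodromy of $f$ is contained in $\mathrm{PSU}(2)$, then one can take $\mathfrak L=\mathrm{id}$ in 2. -/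

import Mathlib

open Filter Topology Set Manifold ContDiff Matrix MatrixGroups

noncomputable section

/-! ### Möbius transformations of the Riemann sphere `OnePoint ℂ` -/

/-- The quotient topology on `PGL(2, ℂ)`. -/
instance pglTopologicalSpace : TopologicalSpace PGL(2, ℂ) :=
  inferInstanceAs (TopologicalSpace (GL (Fin 2) ℂ ⧸ Subgroup.center (GL (Fin 2) ℂ)))

theorem scalar_smul_onePoint (u : ℂˣ) (w : OnePoint ℂ) :
    GeneralLinearGroup.scalar (Fin 2) u • w = w := by
  induction w using OnePoint.rec with
  | infty => simp [OnePoint.smul_infty_eq_ite]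
  | coe z => simp [OnePoint.smul_some_eq_ite]

/-- `PGL(2, ℂ)` acts on the Riemann sphere by `w ↦ (a w + b) / (c w + d)`. -/
instance pglMulAction : MulAction PGL(2, ℂ) (OnePoint ℂ) :=
  ProjGenLinGroup.mulActionOfGL scalar_smul_onePoint

/-- `PSU(2)`, the image of `SU(2)` in `PGL(2, ℂ)`: the transformations
`w ↦ (a w + b) / (- conj b * w + conj a)` with `|a|² + |b|² = 1`. -/
def PSU2 : Set PGL(2, ℂ) :=
  {L | ∃ g : GL (Fin 2) ℂ, (g : Matrix (Fin 2) (Fin 2) ℂ) ∈ specialUnitaryGroup (Fin 2) ℂ ∧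
    ProjGenLinGroup.mk g = L}

/-- The coordinate `w` on the Riemann sphere minus `∞` (with junk value `0` at `∞`). -/
def affineCoord (w : OnePoint ℂ) : ℂ := w.elim 0 id

/-- The coordinate `1 / w` on the Riemann sphere minus `0`, with value `0` at `∞`
(and junk value `0` at `0`). -/
def inftyCoord (w : OnePoint ℂ) : ℂ := (affineCoord w)⁻¹

/-- `u` is holomorphic at `z` as a map to the Riemann sphere, i.e. `u` is a meromorphic function
near `z`. -/
def SphereHolomorphicAt (u : ℂ → OnePoint ℂ) (z : ℂ) : Prop :=
  ContinuousAt u z ∧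
    (u z ≠ OnePoint.infty → AnalyticAt ℂ (fun w => affineCoord (u w)) z) ∧
    (u z = OnePoint.infty → AnalyticAt ℂ (fun w => inftyCoord (u w)) z)

/-- The function `ρ` such that the pullback under `u` of the standard metric
`4 |dw|² / (1 + |w|²)²` is `ρ(z)² |dz|²`. In the coordinate `1 / w` the standard metric has the same
expression as in the coordinate `w`. -/
def sphericalDensity (u : ℂ → OnePoint ℂ) (z : ℂ) : ℝ :=
  open Classical in
  if u z = OnePoint.infty then
    2 * ‖deriv (fun w => inftyCoord (u w)) z‖ / (1 + ‖inftyCoord (u z)‖ ^ 2)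
  else
    2 * ‖deriv (fun w => affineCoord (u w)) z‖ / (1 + ‖affineCoord (u z)‖ ^ 2)

/-- The Schwarzian derivative `{u, z} = u''' / u' - (3 / 2) (u'' / u')²`. -/
def schwarzian (u : ℂ → ℂ) (z : ℂ) : ℂ :=
  iteratedDeriv 3 u z / deriv u z - 3 / 2 * (iteratedDeriv 2 u z / deriv u z) ^ 2

/-! ### Multivalued functions -/

section Surface

variable {X : Type*} [TopologicalSpace X] [ChartedSpace ℂ X]

/-- `h` is meromorphic and injective near the point `x` of the Riemann surface `X`. -/
def IsUnivalentAt (h : X → OnePoint ℂ) (x : X) : Prop :=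
  SphereHolomorphicAt (fun z => h ((chartAt ℂ x).symm z)) (chartAt ℂ x x) ∧
    ∃ U ∈ 𝓝 x, InjOn h U

/-- `H t`, for `0 ≤ t ≤ 1`, is a continuation along the path `γ`: `H t` matters only
near `γ t`, and for `s` close to `t` the functions `H s` and `H t` agree near `γ s`. -/
def IsContinuation {x y : X} (γ : Path x y) (H : unitInterval → X → OnePoint ℂ) : Prop :=
  ∀ t, ∀ᶠ s in 𝓝 t, H s =ᶠ[𝓝 (γ s)] H t

/-- A multivalued locally univalent meromorphic function on the open subset `S` of `X`, given by the
collection of all its function elements. Here `IsElement x h` says that `h`, restricted to a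
small neighbourhood of `x`, is a function element at `x`. The elements are locally univalent and
meromorphic, can be continued along every path in `S` (the results being elements again), and any
two of them are obtained from each other by analytic continuation along a path in `S`. -/
structure MultivaluedFunction (S : Set X) where
  IsElement : X → (X → OnePoint ℂ) → Prop
  mem_domain : ∀ {x h}, IsElement x h → x ∈ S
  congr : ∀ {x h k}, IsElement x h → h =ᶠ[𝓝 x] k → IsElement x k
  nonempty : ∃ x h, IsElement x h
  univalent : ∀ {x h}, IsElement x h → IsUnivalentAt h x
  nearby : ∀ {x h}, IsElement x h → ∀ᶠ y in 𝓝 x, IsElement y h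
  continuation : ∀ {x y : X} (γ : Path x y), (∀ t, γ t ∈ S) → ∀ h, IsElement x h →
    ∃ H, IsContinuation γ H ∧ (∀ t, IsElement (γ t) (H t)) ∧ H 0 =ᶠ[𝓝 x] h
  connected : ∀ {x y : X} {h k}, IsElement x h → IsElement y k →
    ∃ γ : Path x y, (∀ t, γ t ∈ S) ∧
      ∃ H, IsContinuation γ H ∧ (∀ t, IsElement (γ t) (H t)) ∧ H 0 =ᶠ[𝓝 x] h ∧ H 1 =ᶠ[𝓝 y] k

namespace MultivaluedFunction

variable {S : Set X} (f : MultivaluedFunction S)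

/-- Any two function elements at the same point are related by a Möbius transformation. -/
def IsProjective : Prop :=
  ∀ x h k, f.IsElement x h → f.IsElement x k → ∃ L : PGL(2, ℂ), h =ᶠ[𝓝 x] fun y => L • k y

/-- The monodromy of `f`: the Möbius transformations `L` such that the continuation of some function
element `h` along some loop in `S` ends with `L ∘ h`. (For projective `f` on a Riemann surface, every
function element yields the same set of transformations.) -/
def monodromy : Set PGL(2, ℂ) :=
  {L | ∃ (x : X) (γ : Path x x) (H : unitInterval → X → OnePoint ℂ),
    (∀ t, γ t ∈ S) ∧ IsContinuation γ H ∧ (∀ t, f.IsElement (γ t) (H t)) ∧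
      H 1 =ᶠ[𝓝 x] fun y => L • H 0 y}

/-- `f` has a regular singularity of weight `c` at `p`: in some complex coordinate `z` centred at `p`
the Schwarzian of `f` is `c / z² + d / z + ψ(z)` on a punctured neighbourhood of `p`, with a
constant `d` and a function `ψ` holomorphic near `0`. -/
def HasRegularSingularity (p : X) (c : ℂ) : Prop :=
  ∃ e ∈ IsManifold.maximalAtlas 𝓘(ℂ) ω X, p ∈ e.source ∧ e p = 0 ∧
    ∃ (d : ℂ) (ψ : ℂ → ℂ), AnalyticAt ℂ ψ 0 ∧
      ∀ᶠ x in 𝓝[≠] p, ∀ h, f.IsElement x h → h x ≠ OnePoint.infty →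
        schwarzian (fun z => affineCoord (h (e.symm z))) (e x) =
          c / (e x) ^ 2 + d / e x + ψ (e x)

/-- There are a complex coordinate `z` on a neighbourhood of `p`, centred at `p`, and a Möbius
transformation `L` such that `L ∘ f` is `z ^ α` on the punctured neighbourhood: all the branches
`exp (α log z)` of the multivalued function `z ^ α` are given by `L ∘ h` with `h` an element of
`f`. -/
def HasPowerForm (p : X) (α : ℝ) : Prop :=
  ∃ e ∈ IsManifold.maximalAtlas 𝓘(ℂ) ω X, p ∈ e.source ∧ e p = 0 ∧
    ∃ L : PGL(2, ℂ), ∀ x ∈ e.source, x ≠ p →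
      ∀ ℓ : ℂ → ℂ, AnalyticAt ℂ ℓ (e x) → (∀ᶠ z in 𝓝 (e x), Complex.exp (ℓ z) = z) →
        ∃ h, f.IsElement x h ∧
          ∀ᶠ y in 𝓝 x, L • h y = ((Complex.exp (α * ℓ (e y)) : ℂ) : OnePoint ℂ)

end MultivaluedFunction

/-! ### Conformal metrics -/

/-- A smooth conformal metric on the open subset `S` of the Riemann surface `X`, written as
`ρ(z)² |dz|²` with `ρ = density e` in the complex coordinate `z = e`. -/
structure ConformalMetric (S : Set X) where
  density : OpenPartialHomeomorph X ℂ → ℂ → ℝ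
  density_pos : ∀ e ∈ IsManifold.maximalAtlas 𝓘(ℂ) ω X, ∀ x ∈ e.source ∩ S, 0 < density e (e x)
  contDiffOn_density : ∀ e ∈ IsManifold.maximalAtlas 𝓘(ℂ) ω X,
    ContDiffOn ℝ ∞ (density e) (e '' (e.source ∩ S))
  density_change : ∀ e ∈ IsManifold.maximalAtlas 𝓘(ℂ) ω X,
    ∀ e' ∈ IsManifold.maximalAtlas 𝓘(ℂ) ω X, ∀ x ∈ e.source ∩ e'.source ∩ S,
      density e (e x) = density e' (e' x) * ‖deriv (fun z => e' (e.symm z)) (e x)‖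

namespace ConformalMetric

variable {S : Set X} (g : ConformalMetric S)

/-- The Gauss curvature `- ρ⁻² Δ log ρ` of `ρ² |dz|²` is equal to `κ`. -/
def HasConstantCurvature (κ : ℝ) : Prop :=
  ∀ e ∈ IsManifold.maximalAtlas 𝓘(ℂ) ω X, ∀ x ∈ e.source ∩ S,
    -(Laplacian.laplacian (fun z : ℂ => Real.log (g.density e z)) (e x) : ℝ)
      / g.density e (e x) ^ 2 = κ

/-- `g` is the pullback of the standard metric on the Riemann sphere under `L ∘ f`, that is, under
`L ∘ h` for every function element `h` of `f`. -/
def IsPullback (f : MultivaluedFunction S) (L : PGL(2, ℂ)) : Prop :=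
  ∀ e ∈ IsManifold.maximalAtlas 𝓘(ℂ) ω X, ∀ x ∈ e.source, ∀ h, f.IsElement x h →
    g.density e (e x) = sphericalDensity (fun z => L • h (e.symm z)) (e x)

/-- `g` has a conical singularity of angle `2 π α` at `p`: in some complex coordinate `z` centred
at `p` one has `g = exp (2 φ) |dz|²`, where `φ - (α - 1) log |z|` extends continuously to `z = 0`. -/
def HasConicalSingularity (p : X) (α : ℝ) : Prop :=
  ∃ e ∈ IsManifold.maximalAtlas 𝓘(ℂ) ω X, p ∈ e.source ∧ e p = 0 ∧ e.source \ {p} ⊆ S ∧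
    ∃ ψ : ℂ → ℝ, ContinuousOn ψ e.target ∧ ∀ z ∈ e.target, z ≠ 0 →
      Real.log (g.density e z) - (α - 1) * Real.log ‖z‖ = ψ z

/-- `g` represents the divisor `∑ j, (α j - 1) p j`; here `S` is meant to be the complement of
the set of the points `p j`. -/
def RepresentsDivisor {n : ℕ} (p : Fin n → X) (α : Fin n → ℝ) : Prop :=
  ∀ j, g.HasConicalSingularity (p j) (α j)

end ConformalMetric

end Surface

end

noncomputable section

/-! ### Homogeneous coordinates on the Riemann sphere -/

/-! Take `α = √(1 - 2c)` at each singular point. Functions with Schwarzian `s` are quotients of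
solutions of `2y'' + s y = 0`, so equal Schwarzians mean equality up to a Möbius map
(`exists_moebius_of_schwarzian_eq`). At a regular singularity of weight `(1 - α²)/2` the exponents
are `(1 ± α)/2`. The larger one always has a solution `y = z^((1+α)/2) v` with `v` holomorphic and
`v(0) = 1`, and a primitive of `1/y² = z^(-1-α) v⁻²` has the prescribed Schwarzian. Termwise
integration gives `z^(-α) W + C log z` with `W(0) ≠ 0`, where `C ≠ 0` is possible only for integral
`α` (`exists_modelFun`). All elements of `f` near the point are Möbius images of branches of this
model.

Compactness of the monodromy group excludes the logarithm. Integrating `|det g|⁻¹ g gᴴ` over a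
compact group against Haar measure yields an invariant positive definite form, so the group is
conjugate into `PSU(2)` (`exists_conj_subset_PSU2`). If `C ≠ 0`, then `z^(-α)` is single-valued, one
turn around the point translates the model by `2πiC`, and a conjugate of this translation lies in
the monodromy. A nontrivial translation is never conjugate into `PSU(2)`, hence `C = 0`
(`log_coeff_eq_zero`). A root of `W / W(0)` is then absorbed into the coordinate, and an inversion
produces `z^α`.

For the metric, if `L` conjugates the monodromy into `PSU(2)`, the elements of `L ∘ f` at a point
differ by isometries of the sphere, so the pullback is well defined. With `L ∘ h = [a : b]` its
density is `2|a'b - ab'| / (|a|² + |b|²)`. The numerator has a harmonic logarithm, and the Laplacian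
of the logarithm of the denominator gives curvature `1`. Near a singular point, `L ∘ f` is a Möbius
map applied to `z^α`, so the density is `|z|^(α-1)` times a positive function with a continuous
extension. When the monodromy already lies in `PSU(2)`, the identity serves as `L`. -/

/-- The point `[a : b]` of the Riemann sphere. -/
def sphereMk (a b : ℂ) : OnePoint ℂ :=
  open Classical in if b = 0 then OnePoint.infty else ((a / b : ℂ) : OnePoint ℂ)

theorem sphereMk_zero_right (a : ℂ) : sphereMk a 0 = OnePoint.infty := by simp [sphereMk]

theorem sphereMk_of_ne {a b : ℂ} (hb : b ≠ 0) : sphereMk a b = ((a / b : ℂ) : OnePoint ℂ) := by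
  simp [sphereMk, hb]

theorem sphereMk_one_right (a : ℂ) : sphereMk a 1 = (a : OnePoint ℂ) := by simp [sphereMk]

theorem affineCoord_coe (w : ℂ) : affineCoord (w : OnePoint ℂ) = w := rfl

theorem affineCoord_infty : affineCoord OnePoint.infty = 0 := rfl

theorem coe_affineCoord {w : OnePoint ℂ} (h : w ≠ OnePoint.infty) :
    ((affineCoord w : ℂ) : OnePoint ℂ) = w := by
  induction w using OnePoint.rec with
  | infty => exact absurd rfl h
  | coe z => rfl

/-- Equality is tested by cross-multiplication. The pair `(0, 0)` must be excluded because
`sphereMk` sends it to `∞` as a junk value. -/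
theorem sphereMk_eq_iff {a b a' b' : ℂ} (h : a ≠ 0 ∨ b ≠ 0) (h' : a' ≠ 0 ∨ b' ≠ 0) :
    sphereMk a b = sphereMk a' b' ↔ a * b' = a' * b := by
  by_cases hb : b = 0 <;> by_cases hb' : b' = 0
  · simp [hb, hb', sphereMk]
  · simp_all [sphereMk]
  · simp_all [sphereMk]
  · rw [sphereMk_of_ne hb, sphereMk_of_ne hb', OnePoint.coe_eq_coe, div_eq_div_iff hb hb']

theorem pgl_mk_smul (g : GL (Fin 2) ℂ) (w : OnePoint ℂ) : ProjGenLinGroup.mk g • w = g • w :=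
  ProjGenLinGroup.mk_smul ..

theorem gl_det_ne_zero (g : GL (Fin 2) ℂ) : g 0 0 * g 1 1 - g 0 1 * g 1 0 ≠ 0 := by
  have := g.det_ne_zero
  rwa [Matrix.det_fin_two] at this

theorem gl_apply_ne_zero (g : GL (Fin 2) ℂ) {a b : ℂ} (h : a ≠ 0 ∨ b ≠ 0) :
    g 0 0 * a + g 0 1 * b ≠ 0 ∨ g 1 0 * a + g 1 1 * b ≠ 0 := by
  by_contra! H
  have hd := gl_det_ne_zero g
  have h1 : (g 0 0 * g 1 1 - g 0 1 * g 1 0) * a = 0 := by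
    linear_combination g 1 1 * H.1 - g 0 1 * H.2
  have h2 : (g 0 0 * g 1 1 - g 0 1 * g 1 0) * b = 0 := by
    linear_combination g 0 0 * H.2 - g 1 0 * H.1
  simp_all

/-- In homogeneous coordinates the action is linear, which spares later arguments the case
distinction at poles. -/
theorem smul_sphereMk (g : GL (Fin 2) ℂ) {a b : ℂ} (h : a ≠ 0 ∨ b ≠ 0) :
    ProjGenLinGroup.mk g • sphereMk a b =
      sphereMk (g 0 0 * a + g 0 1 * b) (g 1 0 * a + g 1 1 * b) := by
  rw [pgl_mk_smul]
  by_cases hb : b = 0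
  · subst hb
    have ha : a ≠ 0 := by simpa using h
    rw [sphereMk_zero_right, OnePoint.smul_infty_eq_ite]
    by_cases hc : g 1 0 = 0
    · simp [hc, sphereMk]
    · rw [if_neg hc, sphereMk_of_ne (by simp [hc, ha])]
      congr 1
      simp only [mul_zero, add_zero]
      rw [mul_div_mul_right _ _ ha]
  · rw [sphereMk_of_ne hb, OnePoint.smul_some_eq_ite]
    have e : g 1 0 * (a / b) + g 1 1 = (g 1 0 * a + g 1 1 * b) / b := by field_simp
    have e' : g 0 0 * (a / b) + g 0 1 = (g 0 0 * a + g 0 1 * b) / b := by field_simp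
    by_cases hc : g 1 0 * a + g 1 1 * b = 0
    · simp [e, hc, sphereMk]
    · rw [if_neg (by rw [e]; exact div_ne_zero hc hb), sphereMk_of_ne hc, e, e']
      congr 1
      field_simp

/-- A Möbius transformation fixing three complex numbers is the identity. -/
theorem pgl_eq_one_of_fixed {L : PGL(2, ℂ)} {x y z : ℂ} (hxy : x ≠ y) (hxz : x ≠ z) (hyz : y ≠ z)
    (hx : L • (x : OnePoint ℂ) = x) (hy : L • (y : OnePoint ℂ) = y)
    (hz : L • (z : OnePoint ℂ) = z) : L = 1 := by
  induction L using ProjGenLinGroup.induction_on with | mk g =>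
  have key : ∀ w : ℂ, ProjGenLinGroup.mk g • (w : OnePoint ℂ) = w →
      g 0 0 * w + g 0 1 = w * (g 1 0 * w + g 1 1) := by
    intro w hw
    rw [← sphereMk_one_right, smul_sphereMk g (by simp),
      sphereMk_eq_iff (gl_apply_ne_zero g (by simp)) (by simp)] at hw
    simpa using hw
  have h1 := key x hx
  have h2 := key y hy
  have h3 := key z hz
  -- The three points are roots of the quadratic `g₁₀ w² + (g₁₁ - g₀₀) w - g₀₁`. Successive divided
  -- differences show that all its coefficients vanish.
  have h4 : (x - y) * (g 1 0 * (x + y) + (g 1 1 - g 0 0)) = 0 := by linear_combination h2 - h1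
  have h5 : (x - z) * (g 1 0 * (x + z) + (g 1 1 - g 0 0)) = 0 := by linear_combination h3 - h1
  replace h4 := (mul_eq_zero.1 h4).resolve_left (sub_ne_zero.2 hxy)
  replace h5 := (mul_eq_zero.1 h5).resolve_left (sub_ne_zero.2 hxz)
  have h6 : (y - z) * g 1 0 = 0 := by linear_combination h4 - h5
  have hc := (mul_eq_zero.1 h6).resolve_left (sub_ne_zero.2 hyz)
  have had : g 1 1 = g 0 0 := by simpa [hc, sub_eq_zero] using h4
  have hb : g 0 1 = 0 := by simpa [hc, had, mul_comm] using h1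
  have ha : g 0 0 ≠ 0 := by
    intro h0
    exact gl_det_ne_zero g (by simp [h0, hc])
  rw [← ProjGenLinGroup.mk_scalar (Units.mk0 _ ha)]
  congr 1
  ext i j
  fin_cases i <;> fin_cases j <;> simp [hc, had, hb]

/-- A Möbius transformation is determined by its values on three complex numbers. -/
theorem pgl_eq_of_eq_on_nhds {T : Type*} [TopologicalSpace T] {L L' : PGL(2, ℂ)} {x : T}
    [(𝓝[≠] x).NeBot] [T1Space T] {u : T → OnePoint ℂ} (hu : ∃ U ∈ 𝓝 x, InjOn u U)
    (h : ∀ᶠ y in 𝓝 x, L • u y = L' • u y) : L = L' := by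
  obtain ⟨U, hU, hinj⟩ := hu
  -- The point is not isolated and `u` is injective on `U`, so `u` takes infinitely many values
  -- there; three distinct finite ones suffice.
  have hinf : (U ∩ {y | L • u y = L' • u y}).Infinite := infinite_of_mem_nhds x (inter_mem hU h)
  have him := hinf.image (hinj.mono inter_subset_left)
  have him' := him.sdiff (finite_singleton OnePoint.infty)
  obtain ⟨a, ha⟩ := him'.nonempty
  obtain ⟨b, hb⟩ := (him'.sdiff (finite_singleton a)).nonempty
  obtain ⟨c, hc⟩ := ((him'.sdiff (finite_singleton a)).sdiff (finite_singleton b)).nonempty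
  have fix : ∀ w ∈ u '' (U ∩ {y | L • u y = L' • u y}) \ {OnePoint.infty},
      (L'⁻¹ * L) • ((affineCoord w : ℂ) : OnePoint ℂ) = affineCoord w := by
    rintro w ⟨⟨y, ⟨-, hy⟩, rfl⟩, hw⟩
    rw [coe_affineCoord hw, mul_smul, hy, inv_smul_smul]
  have dist : ∀ {v w : OnePoint ℂ}, v ∉ ({OnePoint.infty} : Set _) →
      w ∉ ({OnePoint.infty} : Set _) → w ∉ ({v} : Set _) → affineCoord v ≠ affineCoord w := by
    intro v w hv hw hvw h
    apply hvw
    rw [mem_singleton_iff, ← coe_affineCoord hv, ← coe_affineCoord hw, h]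
  have := pgl_eq_one_of_fixed (dist ha.2 hb.1.2 hb.2) (dist ha.2 hc.1.1.2 hc.1.2)
    (dist hb.1.2 hc.1.1.2 hc.2) (fix a ha) (fix b hb.1) (fix c hc.1.1)
  exact (inv_mul_eq_one.1 this).symm

/-! ### Holomorphic lifts to homogeneous coordinates -/

/-- `u = [a : b]` near `z`, with `a` and `b` holomorphic and without common zero. -/
structure IsLift (u : ℂ → OnePoint ℂ) (a b : ℂ → ℂ) (z : ℂ) : Prop where
  left : AnalyticAt ℂ a z
  right : AnalyticAt ℂ b z
  ne_zero : a z ≠ 0 ∨ b z ≠ 0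
  eq : ∀ᶠ w in 𝓝 z, u w = sphereMk (a w) (b w)

theorem SphereHolomorphicAt.eventually_eq_affineCoord {u : ℂ → OnePoint ℂ} {z : ℂ}
    (h : SphereHolomorphicAt u z) (hz : u z ≠ OnePoint.infty) :
    ∀ᶠ w in 𝓝 z, u w = (affineCoord (u w) : OnePoint ℂ) := by
  filter_upwards [h.1.eventually (isOpen_ne.mem_nhds hz)] with w hw
  rw [coe_affineCoord hw]

/-- By continuity `u` avoids `0` near a pole, and `0` is the only point where `inftyCoord` takes a
junk value. -/
theorem SphereHolomorphicAt.eventually_eq_inftyCoord {u : ℂ → OnePoint ℂ} {z : ℂ}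
    (h : SphereHolomorphicAt u z) (hz : u z = OnePoint.infty) :
    ∀ᶠ w in 𝓝 z, u w = sphereMk 1 (inftyCoord (u w)) := by
  have : ∀ᶠ w in 𝓝 z, u w ≠ ((0 : ℂ) : OnePoint ℂ) :=
    h.1.eventually (isOpen_ne.mem_nhds (by simp [hz]))
  filter_upwards [this] with w hw
  by_cases hw' : u w = OnePoint.infty
  · simp [hw', inftyCoord, affineCoord_infty, sphereMk]
  · rw [← coe_affineCoord hw'] at hw ⊢
    have h0 : affineCoord (u w) ≠ 0 := fun h => hw (by rw [h])
    rw [sphereMk_of_ne (by simpa [inftyCoord, affineCoord_coe] using h0)]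
    simp [inftyCoord, affineCoord_coe]

theorem SphereHolomorphicAt.exists_isLift {u : ℂ → OnePoint ℂ} {z : ℂ}
    (h : SphereHolomorphicAt u z) : ∃ a b, IsLift u a b z := by
  by_cases hz : u z = OnePoint.infty
  · exact ⟨fun _ => 1, fun w => inftyCoord (u w), analyticAt_const, h.2.2 hz, by simp,
      h.eventually_eq_inftyCoord hz⟩
  · refine ⟨fun w => affineCoord (u w), fun _ => 1, h.2.1 hz, analyticAt_const, by simp, ?_⟩
    filter_upwards [h.eventually_eq_affineCoord hz] with w hw
    rwa [sphereMk_one_right]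

theorem SphereHolomorphicAt.comp {u : ℂ → OnePoint ℂ} {τ : ℂ → ℂ} {z : ℂ}
    (h : SphereHolomorphicAt u (τ z)) (hτ : AnalyticAt ℂ τ z) :
    SphereHolomorphicAt (fun w => u (τ w)) z :=
  ⟨h.1.comp hτ.continuousAt, fun hz => (h.2.1 hz).fun_comp hτ, fun hz => (h.2.2 hz).fun_comp hτ⟩

theorem SphereHolomorphicAt.congr {u v : ℂ → OnePoint ℂ} {z : ℂ} (h : SphereHolomorphicAt u z)
    (hv : v =ᶠ[𝓝 z] u) : SphereHolomorphicAt v z :=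
  ⟨h.1.congr hv.symm,
    fun hz => (h.2.1 (hv.self_of_nhds ▸ hz)).congr (hv.symm.fun_comp affineCoord),
    fun hz => (h.2.2 (hv.self_of_nhds ▸ hz)).congr (hv.symm.fun_comp inftyCoord)⟩

namespace IsLift

variable {u : ℂ → OnePoint ℂ} {a b : ℂ → ℂ} {z : ℂ}

theorem eventually_ne_zero (h : IsLift u a b z) : ∀ᶠ w in 𝓝 z, a w ≠ 0 ∨ b w ≠ 0 := by
  rcases h.ne_zero with h0 | h0
  · filter_upwards [h.left.continuousAt.eventually_ne h0] with w hw using Or.inl hw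
  · filter_upwards [h.right.continuousAt.eventually_ne h0] with w hw using Or.inr hw

theorem eventually (h : IsLift u a b z) : ∀ᶠ w in 𝓝 z, IsLift u a b w := by
  filter_upwards [h.left.eventually_analyticAt, h.right.eventually_analyticAt,
    h.eventually_ne_zero, h.eq.eventually_nhds] with w h1 h2 h3 h4 using ⟨h1, h2, h3, h4⟩

theorem congr {v : ℂ → OnePoint ℂ} (h : IsLift u a b z) (hv : ∀ᶠ w in 𝓝 z, v w = u w) :
    IsLift v a b z :=
  ⟨h.left, h.right, h.ne_zero, by filter_upwards [h.eq, hv] with w h1 h2 using h2.trans h1⟩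

theorem smul (h : IsLift u a b z) (g : GL (Fin 2) ℂ) :
    IsLift (fun w => ProjGenLinGroup.mk g • u w) (fun w => g 0 0 * a w + g 0 1 * b w)
      (fun w => g 1 0 * a w + g 1 1 * b w) z where
  left := (analyticAt_const.mul h.left).add (analyticAt_const.mul h.right)
  right := (analyticAt_const.mul h.left).add (analyticAt_const.mul h.right)
  ne_zero := gl_apply_ne_zero g h.ne_zero
  eq := by
    filter_upwards [h.eq, h.eventually_ne_zero] with w h1 h2
    rw [h1, smul_sphereMk g h2]

theorem comp {τ : ℂ → ℂ} {ζ : ℂ} (h : IsLift u a b (τ ζ)) (hτ : AnalyticAt ℂ τ ζ) :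
    IsLift (fun w => u (τ w)) (fun w => a (τ w)) (fun w => b (τ w)) ζ where
  left := h.left.fun_comp hτ
  right := h.right.fun_comp hτ
  ne_zero := h.ne_zero
  eq := hτ.continuousAt.eventually h.eq

/-- The derivatives of `a / b` and `b / a` are the Wronskian, up to sign, over a square, and that
square cancels against the denominator of the density. Both charts thus give one formula, from which
smoothness, curvature and Möbius behaviour are read off. -/
theorem sphericalDensity_eq (h : IsLift u a b z) :
    sphericalDensity u z =
      2 * ‖deriv a z * b z - a z * deriv b z‖ / (‖a z‖ ^ 2 + ‖b z‖ ^ 2) := by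
  have da := h.left.differentiableAt
  have db := h.right.differentiableAt
  by_cases hb : b z = 0
  · have ha : a z ≠ 0 := by simpa [hb] using h.ne_zero
    have hz : u z = OnePoint.infty := by rw [h.eq.self_of_nhds, hb, sphereMk_zero_right]
    have e : (fun w => inftyCoord (u w)) =ᶠ[𝓝 z] fun w => b w / a w := by
      filter_upwards [h.eq, h.left.continuousAt.eventually_ne ha] with w h1 h2
      rw [h1]
      by_cases hw : b w = 0
      · simp [hw, sphereMk, inftyCoord, affineCoord_infty]
      · rw [sphereMk_of_ne hw, inftyCoord, affineCoord_coe, inv_div]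
    have e2 : deriv (fun w => b w / a w) z = deriv b z / a z := by
      rw [deriv_fun_div db da ha, hb]
      field_simp
      simp
    rw [sphericalDensity, if_pos hz, e.deriv_eq, hz, e2]
    simp only [inftyCoord, affineCoord_infty, hb, norm_div, mul_zero, zero_sub, norm_neg, norm_mul]
    have : ‖a z‖ ≠ 0 := norm_ne_zero_iff.2 ha
    simp
    field_simp
  · have hz : u z ≠ OnePoint.infty := by simp [h.eq.self_of_nhds, sphereMk, hb]
    have e : (fun w => affineCoord (u w)) =ᶠ[𝓝 z] fun w => a w / b w := by
      filter_upwards [h.eq, h.right.continuousAt.eventually_ne hb] with w h1 h2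
      rw [h1, sphereMk_of_ne h2, affineCoord_coe]
    have hb' : ‖b z‖ ≠ 0 := norm_ne_zero_iff.2 hb
    have pos : ‖b z‖ ^ 2 + ‖a z‖ ^ 2 ≠ 0 := by positivity
    have pos' : ‖a z‖ ^ 2 + ‖b z‖ ^ 2 ≠ 0 := by positivity
    have ez : affineCoord (u z) = a z / b z := e.self_of_nhds
    rw [sphericalDensity, if_neg hz, e.deriv_eq, ez, deriv_fun_div da db hb]
    simp only [norm_div, norm_pow]
    field_simp
    ring

/-- A linear change of the lift multiplies its Wronskian by the determinant. -/
theorem sphericalDensity_smul (h : IsLift u a b z) (g : GL (Fin 2) ℂ) :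
    sphericalDensity (fun w => ProjGenLinGroup.mk g • u w) z =
      2 * (‖g 0 0 * g 1 1 - g 0 1 * g 1 0‖ * ‖deriv a z * b z - a z * deriv b z‖) /
        (‖g 0 0 * a z + g 0 1 * b z‖ ^ 2 + ‖g 1 0 * a z + g 1 1 * b z‖ ^ 2) := by
  have da := h.left.differentiableAt
  have db := h.right.differentiableAt
  have e : ∀ p q : ℂ, deriv (fun w => p * a w + q * b w) z = p * deriv a z + q * deriv b z := by
    intro p q
    exact ((da.hasDerivAt.const_mul p).add (db.hasDerivAt.const_mul q)).deriv
  rw [(h.smul g).sphericalDensity_eq, e, e, ← norm_mul]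
  congr 3
  ring_nf

/-- A unitary matrix of determinant one preserves both the Wronskian and `|a|² + |b|²`. -/
theorem sphericalDensity_smul_of_mem_PSU2 (h : IsLift u a b z) {L : PGL(2, ℂ)} (hL : L ∈ PSU2) :
    sphericalDensity (fun w => L • u w) z = sphericalDensity u z := by
  obtain ⟨g, hg, rfl⟩ := hL
  rw [h.sphericalDensity_smul, h.sphericalDensity_eq]
  obtain ⟨hu, hd⟩ := mem_specialUnitaryGroup_iff.1 hg
  rw [Matrix.det_fin_two] at hd
  have hu' := (mem_unitaryGroup_iff').1 hu
  have e := fun i j => congrFun (congrFun hu' i) j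
  have e00 := e 0 0
  have e01 := e 0 1
  have e10 := e 1 0
  have e11 := e 1 1
  simp [Matrix.mul_apply, Fin.sum_univ_two, star_eq_conjTranspose] at e00 e01 e10 e11
  have key : ‖g 0 0 * a z + g 0 1 * b z‖ ^ 2 + ‖g 1 0 * a z + g 1 1 * b z‖ ^ 2 =
      ‖a z‖ ^ 2 + ‖b z‖ ^ 2 := by
    have : ((‖g 0 0 * a z + g 0 1 * b z‖ ^ 2 + ‖g 1 0 * a z + g 1 1 * b z‖ ^ 2 : ℝ) : ℂ) =
        ((‖a z‖ ^ 2 + ‖b z‖ ^ 2 : ℝ) : ℂ) := by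
      push_cast
      simp only [← Complex.conj_mul', map_add, map_mul]
      linear_combination (starRingEnd ℂ (a z)) * a z * e00 + (starRingEnd ℂ (a z)) * b z * e01 +
        (starRingEnd ℂ (b z)) * a z * e10 + (starRingEnd ℂ (b z)) * b z * e11
    exact_mod_cast this
  rw [key, hd, norm_one, one_mul]

end IsLift

/-! ### Injective holomorphic functions -/

/-- The derivative of an injective holomorphic function does not vanish. -/
theorem AnalyticAt.deriv_ne_zero_of_injOn {f : ℂ → ℂ} {z : ℂ} (hf : AnalyticAt ℂ f z)
    (hinj : ∃ U ∈ 𝓝 z, InjOn f U) : deriv f z ≠ 0 := by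
  obtain ⟨U, hU, hinj⟩ := hinj
  intro hd
  have hF : AnalyticAt ℂ (fun w => f w - f z) z := hf.sub analyticAt_const
  have hord : analyticOrderAt (fun w => f w - f z) z ≠ ⊤ := by
    rw [Ne, analyticOrderAt_eq_top]
    intro h
    have h2 : ∀ᶠ w in 𝓝[≠] z, False := by
      filter_upwards [nhdsWithin_le_nhds h, nhdsWithin_le_nhds hU, self_mem_nhdsWithin]
        with w h1 h2 h3
      exact h3 (hinj h2 (mem_of_mem_nhds hU) (sub_eq_zero.1 h1))
    exact (h2.exists).elim fun _ h => h
  obtain ⟨g, hg, hgz, hfg⟩ := (hF.analyticOrderAt_ne_top).1 hord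
  set m := analyticOrderNatAt (fun w => f w - f z) z with hm
  -- Order `0` is impossible because `f - f z` vanishes at `z`, and order `1` would make the
  -- derivative equal to `g z ≠ 0`.
  have hm2 : 2 ≤ m := by
    by_contra! hlt
    have h0 := hfg.self_of_nhds
    interval_cases m
    · simp at h0
      exact hgz h0.symm
    · have : HasDerivAt (fun w => (w - z) ^ 1 • g w) (g z) z := by
        have := ((hasDerivAt_id' z).sub_const z).fun_mul hg.differentiableAt.hasDerivAt
        simpa using this
      have h3 := (this.congr_of_eventuallyEq hfg).add_const (f z)
      simp only [sub_add_cancel] at h3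
      exact hgz (h3.deriv ▸ hd)
  have hm0 : (m : ℂ) ≠ 0 := by
    have : m ≠ 0 := by omega
    exact_mod_cast this
  -- an `m`-th root of `f - f z`
  set k : ℂ → ℂ := fun w => (w - z) * Complex.exp (Complex.log (g w / g z) / m) with hk
  have hroot : AnalyticAt ℂ (fun w => Complex.exp (Complex.log (g w / g z) / m)) z := by
    refine ((hg.div_const).clog ?_ |>.div_const).cexp
    simp [hgz]
  have hka : AnalyticAt ℂ k z := (analyticAt_id.sub analyticAt_const).mul hroot
  have hkd : deriv k z = 1 := by
    have := ((hasDerivAt_id' z).sub_const z).fun_mul hroot.differentiableAt.hasDerivAt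
    have h2 : HasDerivAt k 1 z := by simpa [hgz] using this
    exact h2.deriv
  have hkz : k z = 0 := by simp [hk]
  have hkd' : deriv k z ≠ 0 := by simp [hkd]
  set r := hka.hasStrictDerivAt.localInverse _ _ _ hkd' with hr
  have hra : AnalyticAt ℂ r (k z) := hka.analyticAt_localInverse hkd'
  have hrz : r (k z) = z := HasStrictFDerivAt.localInverse_apply_image ..
  have hri : ∀ᶠ w in 𝓝 (k z), k (r w) = w := HasStrictDerivAt.eventually_right_inverse ..
  rw [hkz] at hra hrz hri
  have hpow : ∀ᶠ w in 𝓝 z, f w - f z = g z * k w ^ m := by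
    filter_upwards [hfg, hg.continuousAt.eventually_ne hgz] with w h1 h2
    rw [h1, hk]
    simp only [mul_pow, ← Complex.exp_nat_mul]
    rw [mul_div_cancel₀ _ hm0, Complex.exp_log (div_ne_zero h2 hgz), smul_eq_mul]
    field_simp
  have hrc : Tendsto r (𝓝 0) (𝓝 z) := by
    have := hra.continuousAt.tendsto
    rwa [hrz] at this
  have hall : ∀ᶠ w in 𝓝 (0 : ℂ), k (r w) = w ∧ f (r w) - f z = g z * k (r w) ^ m ∧ r w ∈ U :=
    hri.and ((hrc.eventually hpow).and (hrc.eventually hU))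
  -- The local inverse `r` of the root `k` sends `w` and `ξ w` to points with the same `m`-th power
  -- of `k`, hence the same value of `f`. Injectivity would force `ξ w = w`.
  set ξ : ℂ := Complex.exp (2 * Real.pi * Complex.I / m) with hξ
  have hprim : IsPrimitiveRoot ξ m := Complex.isPrimitiveRoot_exp m (by omega)
  have hmul : Tendsto (fun w : ℂ => ξ * w) (𝓝 0) (𝓝 0) := by
    have : Tendsto (fun w : ℂ => ξ * w) (𝓝 0) (𝓝 (ξ * 0)) := tendsto_id.const_mul ξ
    simpa using this
  have hcontra : ∀ᶠ w in 𝓝[≠] (0 : ℂ), False := by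
    filter_upwards [nhdsWithin_le_nhds hall, nhdsWithin_le_nhds (hmul.eventually hall),
      self_mem_nhdsWithin] with w h1 h2 h3
    have h4 : f (r w) = f (r (ξ * w)) := by
      have e1 := h1.2.1
      have e2 := h2.2.1
      rw [h1.1] at e1
      rw [h2.1, mul_pow, hprim.pow_eq_one, one_mul] at e2
      linear_combination e1 - e2
    have h5 := congrArg k (hinj h1.2.2 h2.2.2 h4)
    rw [h1.1, h2.1] at h5
    have h6 : (1 - ξ) * w = 0 := by linear_combination h5
    rcases mul_eq_zero.1 h6 with h | h
    · exact hprim.ne_one (by omega) (sub_eq_zero.1 h).symm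
    · exact h3 h
  exact hcontra.exists.elim fun _ h => h

/-- The Wronskian of a lift of a locally injective function does not vanish. -/
theorem IsLift.wronskian_ne_zero {u : ℂ → OnePoint ℂ} {a b : ℂ → ℂ} {z : ℂ} (h : IsLift u a b z)
    (hinj : ∃ U ∈ 𝓝 z, InjOn u U) : deriv a z * b z - a z * deriv b z ≠ 0 := by
  obtain ⟨U, hU, hinj⟩ := hinj
  have da := h.left.differentiableAt
  have db := h.right.differentiableAt
  have hU' := inter_mem (inter_mem hU h.eq) h.eventually_ne_zero
  by_cases hb : b z = 0
  · have ha : a z ≠ 0 := by simpa [hb] using h.ne_zero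
    have hA : AnalyticAt ℂ (fun w => b w / a w) z := h.right.div h.left ha
    have := hA.deriv_ne_zero_of_injOn ⟨_, inter_mem hU' (h.left.continuousAt.eventually_ne ha), by
      rintro x ⟨⟨⟨hx1, hx2⟩, hx3⟩, hx4⟩ y ⟨⟨⟨hy1, hy2⟩, hy3⟩, hy4⟩ hxy
      refine hinj hx1 hy1 ?_
      rw [show u x = _ from hx2, show u y = _ from hy2, sphereMk_eq_iff hx3 hy3]
      have := (div_eq_div_iff hx4 hy4).1 hxy
      linear_combination -this⟩
    rw [deriv_fun_div db da ha] at this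
    intro h0
    apply this
    rw [show deriv b z * a z - b z * deriv a z = 0 by linear_combination -h0, zero_div]
  · have hA : AnalyticAt ℂ (fun w => a w / b w) z := h.left.div h.right hb
    have := hA.deriv_ne_zero_of_injOn ⟨_, inter_mem hU' (h.right.continuousAt.eventually_ne hb), by
      rintro x ⟨⟨⟨hx1, hx2⟩, hx3⟩, hx4⟩ y ⟨⟨⟨hy1, hy2⟩, hy3⟩, hy4⟩ hxy
      refine hinj hx1 hy1 ?_
      rw [show u x = _ from hx2, show u y = _ from hy2, sphereMk_eq_iff hx3 hy3]
      exact (div_eq_div_iff hx4 hy4).1 hxy⟩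
    rw [deriv_fun_div da db hb] at this
    intro h0
    exact this (by rw [h0, zero_div])

/-! ### The Schwarzian derivative and second order linear equations -/

/-- A holomorphic function with vanishing derivative is locally constant. -/
theorem AnalyticAt.eventually_const_of_deriv_eq_zero {f : ℂ → ℂ} {z : ℂ} (hf : AnalyticAt ℂ f z)
    (h : ∀ᶠ w in 𝓝 z, deriv f w = 0) : ∀ᶠ w in 𝓝 z, f w = f z := by
  obtain ⟨r, hr, hball⟩ := Metric.eventually_nhds_iff_ball.1 (h.and hf.eventually_analyticAt)
  filter_upwards [Metric.ball_mem_nhds z hr] with w hw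
  exact Metric.isOpen_ball.is_const_of_deriv_eq_zero (convex_ball z r).isPreconnected
    (fun x hx => (hball x hx).2.differentiableAt.differentiableWithinAt)
    (fun x hx => (hball x hx).1) hw (Metric.mem_ball_self hr)

theorem schwarzian_eq (f : ℂ → ℂ) (z : ℂ) : schwarzian f z =
    deriv (deriv (deriv f)) z / deriv f z - 3 / 2 * (deriv (deriv f) z / deriv f z) ^ 2 := by
  simp [schwarzian, iteratedDeriv_succ]

/-- If `y ^ 2 * f'` is constant, then `y` and `f * y` are solutions of the equation
`2 * y'' + {f, z} * y = 0`. -/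
theorem linear_ode_of_sq_mul_deriv {f y : ℂ → ℂ} {z c : ℂ} (hf : AnalyticAt ℂ f z)
    (hy : AnalyticAt ℂ y z) (hc : c ≠ 0) (h : ∀ᶠ w in 𝓝 z, y w ^ 2 * deriv f w = c) :
    ∀ᶠ w in 𝓝 z, 2 * deriv (deriv y) w = - schwarzian f w * y w ∧
      2 * deriv (deriv fun w => f w * y w) w = - schwarzian f w * (f w * y w) := by
  have hf1 := hf.deriv
  have hf2 := hf1.deriv
  have hy1 := hy.deriv
  -- This is the derivative of `y² f' = c`, divided by `y`. Differentiating once more and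
  -- eliminating `y'` produces the Schwarzian.
  have e1 : ∀ᶠ w in 𝓝 z, 2 * deriv y w * deriv f w + y w * deriv (deriv f) w = 0 := by
    filter_upwards [(show (fun w => y w ^ 2 * deriv f w) =ᶠ[𝓝 z] fun _ => c from h).deriv, h,
      hy.eventually_analyticAt, hf1.eventually_analyticAt] with w h1 h2 h3 h4
    have := (h3.differentiableAt.hasDerivAt.fun_pow 2).fun_mul h4.differentiableAt.hasDerivAt
    rw [this.deriv, deriv_const] at h1
    have hyw : y w ≠ 0 := by rintro h0; simp [h0] at h2; exact hc h2.symm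
    apply mul_left_cancel₀ hyw
    simp at h1
    linear_combination h1
  have e2 : ∀ᶠ w in 𝓝 z, 2 * deriv (deriv y) w * deriv f w + 3 * deriv y w * deriv (deriv f) w +
      y w * deriv (deriv (deriv f)) w = 0 := by
    filter_upwards [(show (fun w => 2 * deriv y w * deriv f w + y w * deriv (deriv f) w)
      =ᶠ[𝓝 z] fun _ => 0 from e1).deriv, hy.eventually_analyticAt, hf1.eventually_analyticAt,
      hy1.eventually_analyticAt, hf2.eventually_analyticAt] with w h1 h2 h3 h4 h5
    have := ((h4.differentiableAt.hasDerivAt.const_mul 2).fun_mul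
      h3.differentiableAt.hasDerivAt).fun_add
      (h2.differentiableAt.hasDerivAt.fun_mul h5.differentiableAt.hasDerivAt)
    rw [this.deriv, deriv_const] at h1
    linear_combination h1
  have e3 : ∀ᶠ w in 𝓝 z, 2 * deriv (deriv y) w = - schwarzian f w * y w := by
    filter_upwards [e1, e2, h] with w h1 h2 h3
    have hf0 : deriv f w ≠ 0 := by rintro h0; simp [h0] at h3; exact hc h3.symm
    rw [schwarzian_eq]
    field_simp
    linear_combination 2 * deriv f w * h2 - 3 * deriv (deriv f) w * h1
  have e4 : (deriv fun w => f w * y w) =ᶠ[𝓝 z] fun w => deriv f w * y w + f w * deriv y w := by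
    filter_upwards [hf.eventually_analyticAt, hy.eventually_analyticAt] with w h1 h2
    exact (h1.differentiableAt.hasDerivAt.fun_mul h2.differentiableAt.hasDerivAt).deriv
  filter_upwards [e1, e3, e4.deriv, hf.eventually_analyticAt, hy.eventually_analyticAt,
    hy1.eventually_analyticAt, hf1.eventually_analyticAt] with w h1 h3 h4 h5 h6 h7 h8
  refine ⟨h3, ?_⟩
  have := (h8.differentiableAt.hasDerivAt.fun_mul h6.differentiableAt.hasDerivAt).fun_add
    (h5.differentiableAt.hasDerivAt.fun_mul h7.differentiableAt.hasDerivAt)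
  rw [h4, this.deriv]
  linear_combination 2 * h1 + f w * h3

/-- Here `y = (f'/f'(z))^(-1/2)`. The normalisation puts the argument of the logarithm at `1` at the
base point, away from the cut. -/
theorem exists_sq_mul_deriv_eq {f : ℂ → ℂ} {z : ℂ} (hf : AnalyticAt ℂ f z) (hf' : deriv f z ≠ 0) :
    ∃ y : ℂ → ℂ, AnalyticAt ℂ y z ∧ ∀ᶠ w in 𝓝 z, y w ^ 2 * deriv f w = deriv f z := by
  refine ⟨fun w => Complex.exp (-(Complex.log (deriv f w / deriv f z) / 2)), ?_, ?_⟩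
  · refine ((hf.deriv.div_const).clog ?_ |>.div_const).neg.cexp
    simp [hf']
  · filter_upwards [hf.deriv.continuousAt.eventually_ne hf'] with w hw
    rw [← Complex.exp_nat_mul]
    have : ((2 : ℕ) : ℂ) * -(Complex.log (deriv f w / deriv f z) / 2) =
      - Complex.log (deriv f w / deriv f z) := by push_cast; ring
    rw [this, Complex.exp_neg, Complex.exp_log (div_ne_zero hw hf')]
    field_simp

/-- The Wronskian of two solutions of `2 y'' + s y = 0` is constant. -/
theorem wronskian_eventually_const {s y₁ y₂ : ℂ → ℂ} {z : ℂ} (h₁ : AnalyticAt ℂ y₁ z)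
    (h₂ : AnalyticAt ℂ y₂ z) (e₁ : ∀ᶠ w in 𝓝 z, 2 * deriv (deriv y₁) w = - s w * y₁ w)
    (e₂ : ∀ᶠ w in 𝓝 z, 2 * deriv (deriv y₂) w = - s w * y₂ w) :
    ∀ᶠ w in 𝓝 z, y₁ w * deriv y₂ w - deriv y₁ w * y₂ w =
      y₁ z * deriv y₂ z - deriv y₁ z * y₂ z := by
  refine AnalyticAt.eventually_const_of_deriv_eq_zero
    (f := fun w => y₁ w * deriv y₂ w - deriv y₁ w * y₂ w)
    ((h₁.mul h₂.deriv).sub (h₁.deriv.mul h₂)) ?_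
  filter_upwards [e₁, e₂, h₁.eventually_analyticAt, h₂.eventually_analyticAt,
    h₁.deriv.eventually_analyticAt, h₂.deriv.eventually_analyticAt] with w h1 h2 h3 h4 h5 h6
  have := (h3.differentiableAt.hasDerivAt.fun_mul h6.differentiableAt.hasDerivAt).fun_sub
    (h5.differentiableAt.hasDerivAt.fun_mul h4.differentiableAt.hasDerivAt)
  rw [this.deriv]
  linear_combination (y₁ w * h2 - y₂ w * h1) / 2

/-- Holomorphic functions with the same Schwarzian differ by a Möbius transformation. -/
theorem exists_moebius_of_schwarzian_eq {f h : ℂ → ℂ} {z : ℂ} (hf : AnalyticAt ℂ f z)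
    (hh : AnalyticAt ℂ h z) (hf' : deriv f z ≠ 0) (hh' : deriv h z ≠ 0)
    (hs : ∀ᶠ w in 𝓝 z, schwarzian h w = schwarzian f w) :
    ∃ L : PGL(2, ℂ), ∀ᶠ w in 𝓝 z, (h w : OnePoint ℂ) = L • (f w : OnePoint ℂ) := by
  obtain ⟨y, hy, hyc⟩ := exists_sq_mul_deriv_eq hf hf'
  obtain ⟨η, hη, hηc⟩ := exists_sq_mul_deriv_eq hh hh'
  have ey := linear_ode_of_sq_mul_deriv hf hy hf' hyc
  have eη := linear_ode_of_sq_mul_deriv hh hη hh' hηc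
  have eη1 : ∀ᶠ w in 𝓝 z, 2 * deriv (deriv η) w = - schwarzian f w * η w := by
    filter_upwards [eη, hs] with w h1 h2 using h2 ▸ h1.1
  have eη2 : ∀ᶠ w in 𝓝 z, 2 * deriv (deriv fun w => h w * η w) w =
      - schwarzian f w * (h w * η w) := by
    filter_upwards [eη, hs] with w h1 h2 using h2 ▸ h1.2
  have hP : AnalyticAt ℂ (fun w => f w * y w) z := hf.mul hy
  have hR : AnalyticAt ℂ (fun w => h w * η w) z := hh.mul hη
  have eP := ey.mono fun w h => h.2
  have ey1 := ey.mono fun w h => h.1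
  have dP : ∀ᶠ w in 𝓝 z, deriv (fun w => f w * y w) w = deriv f w * y w + f w * deriv y w := by
    filter_upwards [hf.eventually_analyticAt, hy.eventually_analyticAt] with w h1 h2
    exact (h1.differentiableAt.hasDerivAt.fun_mul h2.differentiableAt.hasDerivAt).deriv
  have dR : deriv (fun w => h w * η w) z = deriv h z * η z + h z * deriv η z :=
    (hh.differentiableAt.hasDerivAt.fun_mul hη.differentiableAt.hasDerivAt).deriv
  have wA := wronskian_eventually_const hy hη ey1 eη1
  have wB := wronskian_eventually_const hP hη eP eη1
  have wC := wronskian_eventually_const hy hR ey1 eη2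
  have wD := wronskian_eventually_const hP hR eP eη2
  -- The four constants are the Wronskians of the solutions `y`, `f y` with the solutions `η`, `h η`
  -- of the same equation.
  set A := y z * deriv η z - deriv y z * η z
  set B := f z * y z * deriv η z - deriv (fun w => f w * y w) z * η z with hB
  set C := y z * deriv (fun w => h w * η w) z - deriv y z * (h z * η z) with hC
  set D := f z * y z * deriv (fun w => h w * η w) z -
    deriv (fun w => f w * y w) z * (h z * η z) with hD
  -- The Plücker relation: this minor is the product of the Wronskians `y² f'` and `η² h'`.
  have hdet : A * D - B * C = deriv f z * deriv h z := by
    rw [hB, hC, hD, dR, dP.self_of_nhds]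
    have e1 := hyc.self_of_nhds
    have e2 := hηc.self_of_nhds
    linear_combination deriv h z * η z ^ 2 * e1 + deriv f z * e2
  have hdet0 : (!![C, -D; A, -B]).det ≠ 0 := by
    rw [Matrix.det_fin_two_of, show C * -B - -D * A = A * D - B * C by ring, hdet]
    exact mul_ne_zero hf' hh'
  -- With `P = f y` and `ω` the Wronskian of `y` and `P`, one has `A P - B y = ω η` and `C P - D y =
  -- ω h η`. Hence `h = (C f - D) / (A f - B)`.
  refine ⟨ProjGenLinGroup.mk (GeneralLinearGroup.mkOfDetNeZero !![C, -D; A, -B] hdet0), ?_⟩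
  filter_upwards [wA, wB, wC, wD, dP, hyc, hηc] with w h1 h2 h3 h4 h5 h6 h7
  have hη0 : η w ≠ 0 := by rintro h0; simp [h0] at h7; exact hh' h7.symm
  have hy0 : y w ≠ 0 := by rintro h0; simp [h0] at h6; exact hf' h6.symm
  rw [← sphereMk_one_right (f w), smul_sphereMk _ (by simp), ← sphereMk_one_right,
    sphereMk_eq_iff (by simp) (gl_apply_ne_zero _ (by simp))]
  change h w * (A * f w + -B * 1) = (C * f w + -D * 1) * 1
  rw [h5] at h2 h4
  apply mul_left_cancel₀ (mul_ne_zero hη0 hy0)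
  rw [← h1, ← h2, ← h3, ← h4]
  ring

/-- The Schwarzian is invariant under inversion. -/
theorem schwarzian_inv {h : ℂ → ℂ} {z : ℂ} (hh : AnalyticAt ℂ h z) (hh' : deriv h z ≠ 0)
    (h0 : h z ≠ 0) : schwarzian (fun w => (h w)⁻¹) z = schwarzian h z := by
  obtain ⟨y, hy, hyc⟩ := exists_sq_mul_deriv_eq hh hh'
  have e1 := linear_ode_of_sq_mul_deriv hh hy hh' hyc
  -- The companion of `1/h` is `h y`, since `(h y)² (1/h)' = -y² h'`. As `h y` also solves the
  -- equation attached to `h`, the two coefficients agree.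
  have e2 := linear_ode_of_sq_mul_deriv (f := fun w => (h w)⁻¹) (y := fun w => h w * y w)
    (hh.inv h0) (hh.mul hy) (neg_ne_zero.2 hh') (by
      filter_upwards [hyc, hh.eventually_analyticAt, hh.continuousAt.eventually_ne h0]
        with w h1 h2 h3
      rw [(h2.differentiableAt.hasDerivAt.fun_inv h3).deriv, ← h1]
      field_simp)
  have h1 := e1.self_of_nhds.2
  have h2 := e2.self_of_nhds.1
  rw [h1] at h2
  have hy0 : y z ≠ 0 := by
    intro h
    have := hyc.self_of_nhds
    simp [h] at this
    exact hh' this.symm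
  have := mul_right_cancel₀ (mul_ne_zero h0 hy0) h2
  linear_combination this

theorem AnalyticAt.continuousAt_schwarzian {h : ℂ → ℂ} {z : ℂ} (hh : AnalyticAt ℂ h z)
    (hh' : deriv h z ≠ 0) : ContinuousAt (schwarzian h) z := by
  rw [show schwarzian h = _ from funext (schwarzian_eq h)]
  have h1 := hh.deriv.continuousAt
  have h2 := hh.deriv.deriv.continuousAt
  have h3 := hh.deriv.deriv.deriv.continuousAt
  exact (h3.div h1 hh').sub (continuousAt_const.mul ((h2.div h1 hh').pow 2))

/-! ### Power series solutions of equations with a regular singular point -/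

/-- Sums of power series with geometrically bounded coefficients can be differentiated
term by term. -/
theorem exists_analyticAt_hasSum {c : ℕ → ℂ} {C A : ℝ} (hA : 0 < A)
    (hc : ∀ n, ‖c n‖ ≤ C * A ^ n) :
    ∃ F : ℂ → ℂ, AnalyticAt ℂ F 0 ∧ F 0 = c 0 ∧ (∀ᶠ z in 𝓝 0, HasSum (fun n => c n * z ^ n) (F z)) ∧
      ∀ᶠ z in 𝓝 0, HasSum (fun n => (n + 1 : ℕ) * c (n + 1) * z ^ n) (deriv F z) := by
  -- The radius `1 / (2A)` makes the terms at most `C 2⁻ⁿ`, uniformly on the disc.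
  have hbound : ∀ n (w : ℂ), w ∈ Metric.ball (0 : ℂ) (1 / (2 * A)) →
      ‖c n * w ^ n‖ ≤ C * (1 / 2) ^ n := by
    intro n w hw
    rw [mem_ball_zero_iff] at hw
    rw [norm_mul, norm_pow]
    have hw' : A * ‖w‖ ≤ 1 / 2 := by
      calc A * ‖w‖ ≤ A * (1 / (2 * A)) := by gcongr
        _ = 1 / 2 := by field_simp
    calc ‖c n‖ * ‖w‖ ^ n ≤ C * A ^ n * ‖w‖ ^ n := by gcongr; exact hc n
      _ = C * (A * ‖w‖) ^ n := by ring
      _ ≤ C * (1 / 2) ^ n := by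
        have : 0 ≤ C := by have := (norm_nonneg _).trans (hc 0); simpa using this
        gcongr
  have hu : Summable fun n : ℕ => C * (1 / 2 : ℝ) ^ n :=
    (summable_geometric_of_lt_one (by norm_num) (by norm_num)).mul_left C
  have hsum : ∀ w ∈ Metric.ball (0 : ℂ) (1 / (2 * A)), Summable fun n => c n * w ^ n :=
    fun w hw => Summable.of_norm_bounded hu fun n => hbound n w hw
  have hnhds : Metric.ball (0 : ℂ) (1 / (2 * A)) ∈ 𝓝 0 := Metric.ball_mem_nhds _ (by positivity)
  have hdiff : ∀ n, DifferentiableOn ℂ (fun w : ℂ => c n * w ^ n)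
      (Metric.ball (0 : ℂ) (1 / (2 * A))) := fun n => by fun_prop
  refine ⟨fun w => ∑' n, c n * w ^ n, ?_, ?_, ?_, ?_⟩
  · exact (Complex.differentiableOn_tsum_of_summable_norm hu hdiff Metric.isOpen_ball
      hbound).analyticAt hnhds
  · refine (tsum_eq_single 0 fun n hn => ?_).trans (by simp)
    simp [hn]
  · filter_upwards [hnhds] with w hw using (hsum w hw).hasSum
  · filter_upwards [hnhds] with w hw
    have := Complex.hasSum_deriv_of_summable_norm hu hdiff Metric.isOpen_ball hbound hw
    rw [← hasSum_nat_add_iff' 1] at this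
    simpa [mul_assoc, mul_left_comm] using this

theorem HasSum.of_forall_eq {f g : ℕ → ℂ} {s : ℂ} (hf : HasSum f s) (h : ∀ n, g n = f n) :
    HasSum g s := by
  rwa [funext h]

/-- The power series expansion of a holomorphic function. -/
theorem AnalyticAt.exists_hasSum {f : ℂ → ℂ} (hf : AnalyticAt ℂ f 0) :
    ∃ (c : ℕ → ℂ) (C A : ℝ), 0 < A ∧ (∀ n, ‖c n‖ ≤ C * A ^ n) ∧
      ∀ᶠ z in 𝓝 0, HasSum (fun n => c n * z ^ n) (f z) := by
  obtain ⟨p, hp⟩ := hf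
  obtain ⟨C, A, -, hA, h⟩ := p.le_mul_pow_of_radius_pos hp.radius_pos
  refine ⟨p.coeff, C, A, hA, fun n => by simpa using h n, ?_⟩
  simpa [mul_comm] using hasFPowerSeriesAt_iff.1 hp

/-- The coefficients of the power series solution `v` of `z v'' + (1 + α) v' + a v = 0`
with `v 0 = 1`. -/
def frobeniusCoeff (a : ℕ → ℂ) (α : ℝ) : ℕ → ℂ
  | 0 => 1
  | n + 1 => -(∑ i : Fin (n + 1), a (n - i) * frobeniusCoeff a α i) / ((n + 1) * (n + 1 + α))
decreasing_by exact i.2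

/-- This is the coefficient of `zⁿ` in `z v'' + (1 + α) v' + a v`. Positivity of `α` keeps the
indicial factor `(n+1)(n+1+α)` nonzero, so there is no resonance. -/
theorem frobeniusCoeff_succ (a : ℕ → ℂ) {α : ℝ} (hα : 0 < α) (n : ℕ) :
    (n + 1) * (n + 1 + α) * frobeniusCoeff a α (n + 1) +
      ∑ k ∈ Finset.range (n + 1), a (n - k) * frobeniusCoeff a α k = 0 := by
  rw [frobeniusCoeff, ← Fin.sum_univ_eq_sum_range (fun k => a (n - k) * frobeniusCoeff a α k)]
  have h1 : (n + 1 : ℂ) ≠ 0 := by exact_mod_cast n.succ_ne_zero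
  have h2 : (n + 1 + α : ℂ) ≠ 0 := by
    have : (n + 1 + α : ℝ) ≠ 0 := by positivity
    exact_mod_cast this
  field_simp
  ring

/-- With `M = max C A`, each of the `n + 1` terms of the recursion is at most `M^(n+1)`. The
indicial factor is at least `n + 1` and absorbs their number. -/
theorem norm_frobeniusCoeff_le {a : ℕ → ℂ} {α C A : ℝ} (hα : 0 < α) (hA : 0 < A)
    (ha : ∀ n, ‖a n‖ ≤ C * A ^ n) (n : ℕ) : ‖frobeniusCoeff a α n‖ ≤ (max C A) ^ n := by
  induction n using Nat.strong_induction_on with | _ n ih =>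
  cases n with
  | zero => simp [frobeniusCoeff]
  | succ n =>
    have hC : 0 ≤ C := by simpa using (norm_nonneg _).trans (ha 0)
    have h1 := frobeniusCoeff_succ a hα n
    have h2 : ‖((n : ℂ) + 1) * (n + 1 + α)‖ = (n + 1) * (n + 1 + α) := by
      have : ((n : ℂ) + 1) * (n + 1 + α) = (((n + 1) * (n + 1 + α) : ℝ) : ℂ) := by push_cast; ring
      rw [this, Complex.norm_real, Real.norm_of_nonneg (by positivity)]
    have h3 : ((n : ℝ) + 1) * (n + 1 + α) * ‖frobeniusCoeff a α (n + 1)‖ ≤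
        (n + 1) * (max C A) ^ (n + 1) := by
      rw [← h2, ← norm_mul, eq_neg_of_add_eq_zero_left h1, norm_neg]
      refine (norm_sum_le _ _).trans ?_
      have : ∀ k ∈ Finset.range (n + 1), ‖a (n - k) * frobeniusCoeff a α k‖ ≤
          (max C A) ^ (n + 1) := by
        intro k hk
        have hk' := Finset.mem_range.1 hk
        calc ‖a (n - k) * frobeniusCoeff a α k‖
            ≤ (C * A ^ (n - k)) * (max C A) ^ k := by
              rw [norm_mul]
              gcongr
              · exact ha _
              · exact ih k hk'
          _ ≤ (max C A * (max C A) ^ (n - k)) * (max C A) ^ k := by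
              gcongr
              · exact le_max_left _ _
              · exact le_max_right _ _
          _ = (max C A) ^ (n + 1) := by
              rw [mul_assoc, ← pow_add, ← pow_succ']
              congr 1
              omega
      refine (Finset.sum_le_sum this).trans ?_
      simp
    have h4 : (n + 1 : ℝ) * ‖frobeniusCoeff a α (n + 1)‖ ≤
        (n + 1) * (max C A) ^ (n + 1) := by
      refine le_trans ?_ h3
      gcongr
      nlinarith
    exact le_of_mul_le_mul_left h4 (by positivity)

/-- The solution with the larger exponent at a regular singular point. -/
theorem exists_frobenius_solution {a : ℂ → ℂ} (ha : AnalyticAt ℂ a 0) {α : ℝ} (hα : 0 < α) :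
    ∃ v : ℂ → ℂ, AnalyticAt ℂ v 0 ∧ v 0 = 1 ∧
      ∀ᶠ z in 𝓝 0, z * deriv (deriv v) z + (1 + α) * deriv v z + a z * v z = 0 := by
  obtain ⟨c, C, A, hA, hc, hsum⟩ := ha.exists_hasSum
  have hM : 0 < max C A := hA.trans_le (le_max_right _ _)
  set b := frobeniusCoeff c α with hb
  have hbb : ∀ n, ‖b n‖ ≤ 1 * (max C A) ^ n := by
    intro n
    rw [one_mul]
    exact norm_frobeniusCoeff_le hα hA hc n
  obtain ⟨v, hv, hv0, hv1, hv2⟩ := exists_analyticAt_hasSum hM hbb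
  -- The series of `v'` must also be differentiated termwise; the factor `n + 1 ≤ 2ⁿ` only doubles
  -- the geometric ratio.
  have hbb' : ∀ n, ‖((n + 1 : ℕ) : ℂ) * b (n + 1)‖ ≤ max C A * (2 * max C A) ^ n := by
    intro n
    rw [norm_mul, Complex.norm_natCast]
    have h2 : ((n + 1 : ℕ) : ℝ) ≤ 2 ^ n := by exact_mod_cast Nat.lt_two_pow_self
    calc ((n + 1 : ℕ) : ℝ) * ‖b (n + 1)‖ ≤ 2 ^ n * (1 * (max C A) ^ (n + 1)) := by
          gcongr
          exact hbb _
      _ = _ := by ring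
  obtain ⟨v', hv', -, hv1', hv2'⟩ := exists_analyticAt_hasSum (by positivity) hbb'
  refine ⟨v, hv, by simpa [hb, frobeniusCoeff] using hv0, ?_⟩
  have hd : deriv v =ᶠ[𝓝 0] v' := by
    filter_upwards [hv2, hv1'] with z h1 h2 using h1.unique h2
  filter_upwards [hsum, hv1, hv2, hv2', hd.deriv] with z h1 h2 h3 h4 h5
  rw [← h5] at h4
  have h6 : HasSum (fun n => ∑ k ∈ Finset.range (n + 1), c (n - k) * b k * z ^ n) (a z * v z) := by
    have := hasSum_sum_range_mul_of_summable_norm h2.summable.norm h1.summable.norm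
    rw [h1.tsum_eq, h2.tsum_eq, mul_comm] at this
    refine this.of_forall_eq fun n => ?_
    refine Finset.sum_congr rfl fun k hk => ?_
    have hk' : k ≤ n := by have := Finset.mem_range.1 hk; omega
    rw [← Nat.sub_add_cancel hk', pow_add]
    simp
    ring
  have h7 : HasSum (fun n : ℕ => (n : ℂ) * ((n + 1 : ℕ) * b (n + 1)) * z ^ n)
      (z * deriv (deriv v) z) := by
    rw [← hasSum_nat_add_iff' 1]
    have := h4.mul_left z
    simp only [Finset.range_one, Finset.sum_singleton, Nat.cast_zero, zero_mul, sub_zero]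
    refine this.of_forall_eq fun n => ?_
    ring
  have h8 := (h7.add (h3.mul_left (1 + α : ℂ))).add h6
  refine h8.unique ?_
  refine (hasSum_zero : HasSum (fun _ : ℕ => (0 : ℂ)) 0).of_forall_eq fun n => ?_
  have := frobeniusCoeff_succ c hα n
  rw [← Finset.sum_mul]
  push_cast
  linear_combination z ^ n * this

/-- Formal integration of `z ^ (-1 - α) V`: up to a logarithmic term, which occurs only for integral
`α`, the integral is `z ^ (-α) W` with `W` holomorphic. -/
theorem exists_primitive_cofactor {V : ℂ → ℂ} (hV : AnalyticAt ℂ V 0) (α : ℝ) :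
    ∃ (W : ℂ → ℂ) (C : ℂ) (m : ℕ), AnalyticAt ℂ W 0 ∧ W 0 = - V 0 / α ∧ (C ≠ 0 → α = m) ∧
      ∀ᶠ z in 𝓝 0, z * deriv W z - α * W z = V z - C * z ^ m := by
  obtain ⟨c, K, A, hA, hc, hsum⟩ := hV.exists_hasSum
  -- Convergence gives a bound for all `1/(n - α)`, including `n = α`, where the inverse is `0` by
  -- convention.
  have hinv : Tendsto (fun n : ℕ => ((n - α : ℝ) : ℂ)⁻¹) atTop (𝓝 0) := by
    have h1 : Tendsto (fun n : ℕ => (n - α : ℝ)⁻¹) atTop (𝓝 0) :=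
      (tendsto_atTop_add_const_right _ (-α) tendsto_natCast_atTop_atTop).inv_tendsto_atTop
    have := (Complex.continuous_ofReal.tendsto 0).comp h1
    simpa [Function.comp_def] using this
  obtain ⟨B, hB⟩ := isBounded_iff_forall_norm_le.1 (Metric.isBounded_range_of_tendsto _ hinv)
  have hB' : ∀ n : ℕ, ‖((n - α : ℝ) : ℂ)⁻¹‖ ≤ B := fun n => hB _ ⟨n, rfl⟩
  have hB0 : 0 ≤ B := (norm_nonneg _).trans (hB' 0)
  have hbb : ∀ n : ℕ, ‖((n - α : ℝ) : ℂ)⁻¹ * c n‖ ≤ B * K * A ^ n := by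
    intro n
    rw [norm_mul, mul_assoc]
    gcongr
    · exact hB' n
    · exact hc n
  obtain ⟨W, hW, hW0, hW1, hW2⟩ := exists_analyticAt_hasSum hA hbb
  have hc0 : V 0 = c 0 := by
    have h1 := hsum.self_of_nhds
    refine h1.unique ?_
    simpa using hasSum_single (f := fun n : ℕ => c n * (0 : ℂ) ^ n) 0 (by intro n hn; simp [hn])
  have hWz : ∀ᶠ z in 𝓝 0, HasSum (fun n : ℕ => ((n - α : ℝ) : ℂ) * (((n - α : ℝ) : ℂ)⁻¹ * c n) * z ^ n)
      (z * deriv W z - α * W z) := by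
    filter_upwards [hW1, hW2] with z h1 h2
    have h3 : HasSum (fun n : ℕ => (n : ℂ) * (((n - α : ℝ) : ℂ)⁻¹ * c n) * z ^ n)
        (z * deriv W z) := by
      rw [← hasSum_nat_add_iff' 1]
      simp only [Finset.range_one, Finset.sum_singleton, Nat.cast_zero, zero_mul, sub_zero]
      refine (h2.mul_left z).of_forall_eq fun n => ?_
      ring
    refine (h3.sub (h1.mul_left (α : ℂ))).of_forall_eq fun n => ?_
    push_cast
    ring
  have hW0' : W 0 = - V 0 / α := by
    rw [hW0, hc0]
    push_cast
    simp
    field_simp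
  by_cases hint : ∃ m : ℕ, α = m
  · obtain ⟨m, hm⟩ := hint
    refine ⟨W, c m, m, hW, hW0', fun _ => hm, ?_⟩
    filter_upwards [hWz, hsum] with z h1 h2
    have h3 := h2.sub (hasSum_ite_eq m (c m * z ^ m))
    refine h1.unique ?_
    refine h3.of_forall_eq fun n => ?_
    by_cases hn : n = m
    · simp [hn, hm]
    · have : ((n - α : ℝ) : ℂ) ≠ 0 := by
        rw [hm]
        exact Complex.ofReal_ne_zero.2 (sub_ne_zero.2 (Nat.cast_injective.ne hn))
      rw [if_neg hn, mul_inv_cancel_left₀ this, sub_zero]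
  · refine ⟨W, 0, 0, hW, hW0', fun h => absurd rfl h, ?_⟩
    filter_upwards [hWz, hsum] with z h1 h2
    rw [zero_mul, sub_zero]
    refine h1.unique ?_
    refine h2.of_forall_eq fun n => ?_
    have : ((n - α : ℝ) : ℂ) ≠ 0 := by
      have : (n : ℝ) - α ≠ 0 := fun h => hint ⟨n, by linarith⟩
      exact_mod_cast this
    rw [mul_inv_cancel_left₀ this]

/-! ### The model function at a regular singular point -/

/-- The branch of `z ^ (-α) W(z) + C log z` belonging to the branch `ℓ` of the logarithm. -/
def modelFun (W : ℂ → ℂ) (C : ℂ) (α : ℝ) (ℓ : ℂ → ℂ) (z : ℂ) : ℂ :=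
  W z * Complex.exp (-(α * ℓ z)) + C * ℓ z

/-- `ℓ` is a holomorphic branch of the logarithm near `z`. -/
def IsLogBranch (ℓ : ℂ → ℂ) (z : ℂ) : Prop :=
  AnalyticAt ℂ ℓ z ∧ ∀ᶠ w in 𝓝 z, Complex.exp (ℓ w) = w

theorem IsLogBranch.ne_zero {ℓ : ℂ → ℂ} {z : ℂ} (h : IsLogBranch ℓ z) : z ≠ 0 := by
  have := h.2.self_of_nhds
  rw [← this]
  exact Complex.exp_ne_zero _

theorem IsLogBranch.eventually {ℓ : ℂ → ℂ} {z : ℂ} (h : IsLogBranch ℓ z) :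
    ∀ᶠ w in 𝓝 z, IsLogBranch ℓ w := by
  filter_upwards [h.1.eventually_analyticAt, h.2.eventually_nhds] with w h1 h2 using ⟨h1, h2⟩

theorem IsLogBranch.hasDerivAt {ℓ : ℂ → ℂ} {z : ℂ} (h : IsLogBranch ℓ z) :
    HasDerivAt ℓ (1 / z) z := by
  have h1 := h.1.differentiableAt.hasDerivAt
  have h2 := h1.cexp.congr_of_eventuallyEq (EventuallyEq.symm h.2)
  have h3 := h2.unique (hasDerivAt_id' z)
  rw [h.2.self_of_nhds] at h3
  rwa [eq_div_of_mul_eq h.ne_zero ((mul_comm _ _).trans h3)] at h1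

/-- A continuous branch of the logarithm is determined by its value at one point. -/
theorem IsLogBranch.eventuallyEq {ℓ ℓ' : ℂ → ℂ} {z : ℂ} (h : IsLogBranch ℓ z)
    (h' : IsLogBranch ℓ' z) (e : ℓ z = ℓ' z) : ℓ =ᶠ[𝓝 z] ℓ' := by
  have hc : ContinuousAt (fun w => (ℓ w - ℓ' w).im) z :=
    Complex.continuous_im.continuousAt.comp (h.1.continuousAt.sub h'.1.continuousAt)
  have h0 : (fun w => (ℓ w - ℓ' w).im) z = 0 := by simp [e]
  have hpi := Real.pi_pos
  filter_upwards [h.2, h'.2, hc.eventually (Ioo_mem_nhds (by rw [h0]; linarith : -Real.pi < _)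
    (by rw [h0]; exact hpi))] with w h1 h2 h3
  have h4 : Complex.exp (ℓ w - ℓ' w) = 1 := by
    have : w ≠ 0 := h1 ▸ Complex.exp_ne_zero _
    rw [Complex.exp_sub, h1, h2, div_self this]
  have h5 := Complex.log_exp h3.1 h3.2.le
  rw [h4, Complex.log_one] at h5
  exact sub_eq_zero.1 h5.symm

/-- The branch of the logarithm near `exp ζ` with the value `ζ` at this point. -/
def logBranch (ζ w : ℂ) : ℂ := ζ + Complex.log (w / Complex.exp ζ)

theorem logBranch_apply_exp (ζ : ℂ) : logBranch ζ (Complex.exp ζ) = ζ := by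
  simp [logBranch, Complex.exp_ne_zero]

theorem isLogBranch_logBranch (ζ : ℂ) : IsLogBranch (logBranch ζ) (Complex.exp ζ) := by
  refine ⟨analyticAt_const.add (analyticAt_id.div_const.clog ?_), ?_⟩
  · simp [Complex.exp_ne_zero]
  · filter_upwards [isOpen_ne.mem_nhds (Complex.exp_ne_zero ζ)] with w hw
    rw [logBranch, Complex.exp_add, Complex.exp_log (div_ne_zero hw (Complex.exp_ne_zero ζ))]
    field_simp [Complex.exp_ne_zero]

/-- Two logarithms select the same branch when their difference has imaginary part in `(-π, π)`. The
branch is therefore locally constant along a path in the logarithmic plane. -/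
theorem logBranch_eventuallyEq (ζ : ℂ) :
    ∀ᶠ ξ in 𝓝 ζ, logBranch ξ =ᶠ[𝓝 (Complex.exp ξ)] logBranch ζ := by
  have hc : Tendsto (fun ξ : ℂ => (ξ - ζ).im) (𝓝 ζ) (𝓝 0) := by
    have : Continuous fun ξ : ℂ => (ξ - ζ).im := by fun_prop
    simpa using this.tendsto ζ
  have hpi := Real.pi_pos
  filter_upwards [Complex.continuous_exp.continuousAt.eventually
    (isLogBranch_logBranch ζ).eventually,
    hc.eventually (Ioo_mem_nhds (neg_neg_of_pos hpi) hpi)] with ξ h1 h2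
  refine (isLogBranch_logBranch ξ).eventuallyEq h1 ?_
  rw [logBranch_apply_exp, logBranch, ← Complex.exp_sub, Complex.log_exp h2.1 h2.2.le]
  ring

/-- Every function with the Schwarzian `c / z ^ 2 + d / z + ψ`, where `c = (1 - α ^ 2) / 2`, is
Möbius equivalent to a branch of a model function. -/
theorem exists_modelFun {α : ℝ} (hα : 0 < α) (d : ℂ) {ψ : ℂ → ℂ} (hψ : AnalyticAt ℂ ψ 0) :
    ∃ (W : ℂ → ℂ) (C : ℂ) (m : ℕ), AnalyticAt ℂ W 0 ∧ W 0 ≠ 0 ∧ (C ≠ 0 → α = m) ∧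
      ∀ᶠ z in 𝓝[≠] 0, ∀ ℓ, IsLogBranch ℓ z →
        AnalyticAt ℂ (modelFun W C α ℓ) z ∧ deriv (modelFun W C α ℓ) z ≠ 0 ∧
        ∀ᶠ w in 𝓝 z, schwarzian (modelFun W C α ℓ) w =
          ((1 - α ^ 2) / 2 : ℝ) / w ^ 2 + d / w + ψ w := by
  -- Substituting `y = z^((1+α)/2) v` into `2y'' + s y = 0` cancels the double pole and leaves `z
  -- v'' + (1+α) v' + ((d + zψ)/2) v = 0`.
  have ha : AnalyticAt ℂ (fun z => (d + z * ψ z) / 2) 0 :=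
    (analyticAt_const.add (analyticAt_id.mul hψ)).div_const
  obtain ⟨v, hv, hv0, hode⟩ := exists_frobenius_solution ha hα
  have hv0' : v 0 ≠ 0 := by simp [hv0]
  obtain ⟨W, C, m, hW, hW0, hC, hWode⟩ := exists_primitive_cofactor
    (V := fun z => 1 / v z ^ 2) (analyticAt_const.div (hv.pow 2) (pow_ne_zero 2 hv0')) α
  have hαC : (α : ℂ) ≠ 0 := Complex.ofReal_ne_zero.2 hα.ne'
  refine ⟨W, C, m, hW, ?_, hC, ?_⟩
  · rw [hW0, hv0]
    simp [hαC]
  have hall := (hode.and (hWode.and (hv.eventually_analyticAt.and (hW.eventually_analyticAt.and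
    (hv.continuousAt.eventually_ne hv0'))))).eventually_nhds
  filter_upwards [nhdsWithin_le_nhds hall, self_mem_nhdsWithin] with z hz hz0 ℓ hℓ
  have hvz := hz.self_of_nhds.2.2.1
  have hWz := hz.self_of_nhds.2.2.2.1
  -- The model is a primitive of `1/y² = z^(-1-α) v⁻²`.
  have hder : ∀ᶠ w in 𝓝 z, deriv (modelFun W C α ℓ) w =
      Complex.exp (-(α * ℓ w)) / (w * v w ^ 2) := by
    filter_upwards [hz, hℓ.eventually] with w h1 h2
    obtain ⟨-, h3, -, h4, h5⟩ := h1
    have hw := h2.ne_zero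
    have h6 := (h4.differentiableAt.hasDerivAt.fun_mul
      ((h2.hasDerivAt.const_mul (α : ℂ)).fun_neg.cexp)).fun_add (h2.hasDerivAt.const_mul C)
    -- If `C ≠ 0`, then `exp(αℓ) = wᵐ`, so the derivative of `C ℓ` restores exactly the term missing
    -- from the equation of `W`.
    have h7 : C * w ^ m * Complex.exp (-(α * ℓ w)) = C := by
      by_cases hC0 : C = 0
      · simp [hC0]
      · have h8 : Complex.exp (α * ℓ w) = w ^ m := by
          rw [hC hC0, Complex.ofReal_natCast, Complex.exp_nat_mul, h2.2.self_of_nhds]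
        rw [Complex.exp_neg, h8]
        field_simp
    have h6' : deriv (modelFun W C α ℓ) w = _ := h6.deriv
    rw [h6']
    have h9 : deriv W w = (α * W w + 1 / v w ^ 2 - C * w ^ m) / w := by
      field_simp
      field_simp at h3
      linear_combination h3
    rw [h9]
    field_simp
    linear_combination -v w ^ 2 * h7
  have hmod : AnalyticAt ℂ (modelFun W C α ℓ) z :=
    (hWz.mul (analyticAt_const.mul hℓ.1).neg.cexp).add (analyticAt_const.mul hℓ.1)
  refine ⟨hmod, ?_, ?_⟩
  · rw [hder.self_of_nhds]
    exact div_ne_zero (Complex.exp_ne_zero _)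
      (mul_ne_zero hz0 (pow_ne_zero 2 hz.self_of_nhds.2.2.2.2))
  set s : ℂ := (1 + α) / 2 with hs
  have hyan : AnalyticAt ℂ (fun w => Complex.exp (s * ℓ w) * v w) z :=
    (analyticAt_const.mul hℓ.1).cexp.mul hvz
  have hsq : ∀ᶠ w in 𝓝 z, (Complex.exp (s * ℓ w) * v w) ^ 2 * deriv (modelFun W C α ℓ) w = 1 := by
    filter_upwards [hder, hz, hℓ.eventually] with w h1 h2 h3
    have hv := h2.2.2.2.2
    have hw := h3.ne_zero
    have e : Complex.exp (s * ℓ w) ^ 2 * Complex.exp (-(α * ℓ w)) = w := by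
      rw [← Complex.exp_nat_mul, ← Complex.exp_add]
      rw [show ((2 : ℕ) : ℂ) * (s * ℓ w) + -(α * ℓ w) = ℓ w by rw [hs]; push_cast; ring]
      exact h3.2.self_of_nhds
    rw [h1]
    generalize Complex.exp (-(α * ℓ w)) = E at e ⊢
    field_simp
    linear_combination e
  have hd1 : (deriv fun w => Complex.exp (s * ℓ w) * v w) =ᶠ[𝓝 z]
      fun w => Complex.exp (s * ℓ w) * (s * (1 / w)) * v w + Complex.exp (s * ℓ w) * deriv v w := by
    filter_upwards [hz, hℓ.eventually] with w h1 h2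
    exact ((h2.hasDerivAt.const_mul s).cexp.fun_mul
      h1.2.2.1.differentiableAt.hasDerivAt).deriv
  -- Since `y² φ' = 1` for the model `φ`, `y` solves `2y'' + {φ, z} y = 0`. Comparison with the
  -- equation of `v` determines `{φ, z}`.
  filter_upwards [linear_ode_of_sq_mul_deriv hmod hyan one_ne_zero hsq, hd1.deriv, hz,
    hℓ.eventually] with w h1 h2 h3 h4
  obtain ⟨h5, -, h6, -, h7⟩ := h3
  have hw := h4.ne_zero
  have hE := (h4.hasDerivAt.const_mul s).cexp
  have h8 := ((hE.fun_mul (((hasDerivAt_id' w).fun_inv hw).const_mul s)).fun_mul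
    h6.differentiableAt.hasDerivAt).fun_add
    (hE.fun_mul h6.deriv.differentiableAt.hasDerivAt)
  have h9 := h1.1
  simp only [one_div] at h2
  rw [h2, h8.deriv] at h9
  have hEw : Complex.exp (s * ℓ w) ≠ 0 := Complex.exp_ne_zero _
  have h10 : deriv (deriv v) w = -((1 + α) * deriv v w + (d + w * ψ w) / 2 * v w) / w := by
    field_simp
    linear_combination 2 * h5
  rw [h10] at h9
  generalize Complex.exp (s * ℓ w) = E at h9 hEw
  rw [hs] at h9
  push_cast
  field_simp at h9 ⊢
  apply mul_left_cancel₀ h7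
  linear_combination h9

/-- A univalent function with the Schwarzian of `φ` is Möbius equivalent to `φ`. The assumption
on the Schwarzian does not concern the poles. -/
theorem SphereHolomorphicAt.exists_moebius {u : ℂ → OnePoint ℂ} {φ : ℂ → ℂ} {z : ℂ}
    (hu : SphereHolomorphicAt u z) (hinj : ∃ U ∈ 𝓝 z, InjOn u U) (hφ : AnalyticAt ℂ φ z)
    (hφ' : deriv φ z ≠ 0)
    (hs : ∀ᶠ w in 𝓝 z, u w ≠ OnePoint.infty →
      schwarzian (fun w => affineCoord (u w)) w = schwarzian φ w) :
    ∃ L : PGL(2, ℂ), ∀ᶠ w in 𝓝 z, u w = L • (φ w : OnePoint ℂ) := by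
  obtain ⟨U, hU, hinj⟩ := hinj
  by_cases hz : u z = OnePoint.infty
  · have he := hu.eventually_eq_inftyCoord hz
    have hb := hu.2.2 hz
    have hb' := hb.deriv_ne_zero_of_injOn ⟨_, inter_mem hU he, by
      rintro x ⟨hx1, hx2⟩ y ⟨hy1, hy2⟩ hxy
      refine hinj hx1 hy1 ?_
      rw [show u x = _ from hx2, show u y = _ from hy2]
      exact congrArg _ hxy⟩
    -- By injectivity the pole is isolated. Away from it `1/u` has the Schwarzian of `u`, and
    -- continuity then supplies the value at the pole.
    have h1 : ∀ᶠ w in 𝓝[≠] z, schwarzian (fun w => inftyCoord (u w)) w = schwarzian φ w := by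
      filter_upwards [nhdsWithin_le_nhds hs, nhdsWithin_le_nhds hU,
        nhdsWithin_le_nhds he.eventually_nhds, self_mem_nhdsWithin,
        nhdsWithin_le_nhds hb.eventually_analyticAt,
        nhdsWithin_le_nhds (hb.deriv.continuousAt.eventually_ne hb')] with w h1 h2 h3 h4 h5 h6
      have h7 : u w ≠ OnePoint.infty := by
        intro h
        exact h4 (hinj h2 (mem_of_mem_nhds hU) (h.trans hz.symm))
      have h8 : inftyCoord (u w) ≠ 0 := by
        intro h
        have := h3.self_of_nhds
        rw [h, sphereMk_zero_right] at this
        exact h7 this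
      have h9 : (fun w => affineCoord (u w)) = fun w => (inftyCoord (u w))⁻¹ := by
        funext w
        rw [inftyCoord, inv_inv]
      rw [← h1 h7, h9, schwarzian_inv h5 h6 h8]
    have h2 : schwarzian (fun w => inftyCoord (u w)) z = schwarzian φ z :=
      tendsto_nhds_unique_of_eventuallyEq
        ((hb.continuousAt_schwarzian hb').tendsto.mono_left nhdsWithin_le_nhds)
        ((hφ.continuousAt_schwarzian hφ').tendsto.mono_left nhdsWithin_le_nhds) h1
    have h3 : ∀ᶠ w in 𝓝 z, schwarzian (fun w => inftyCoord (u w)) w = schwarzian φ w := by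
      rw [eventually_nhdsWithin_iff] at h1
      filter_upwards [h1] with w hw
      by_cases hwz : w = z
      · rw [hwz, h2]
      · exact hw hwz
    obtain ⟨L, hL⟩ := exists_moebius_of_schwarzian_eq hφ hb hφ' hb' h3
    have hdet : (!![(0 : ℂ), 1; 1, 0]).det ≠ 0 := by simp
    refine ⟨ProjGenLinGroup.mk (GeneralLinearGroup.mkOfDetNeZero _ hdet) * L, ?_⟩
    filter_upwards [hL, he] with w h4 h5
    rw [mul_smul, ← h4, ← sphereMk_one_right, smul_sphereMk _ (by simp)]
    change _ = sphereMk (0 * inftyCoord (u w) + 1 * 1) (1 * inftyCoord (u w) + 0 * 1)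
    simpa using h5
  · have he := hu.eventually_eq_affineCoord hz
    have hb := hu.2.1 hz
    have hb' := hb.deriv_ne_zero_of_injOn ⟨_, inter_mem hU he, by
      rintro x ⟨hx1, hx2⟩ y ⟨hy1, hy2⟩ hxy
      refine hinj hx1 hy1 ?_
      rw [show u x = _ from hx2, show u y = _ from hy2]
      exact congrArg _ hxy⟩
    obtain ⟨L, hL⟩ := exists_moebius_of_schwarzian_eq hφ hb hφ' hb' (by
      filter_upwards [hs, he] with w h1 h2
      exact h1 (by rw [h2]; exact OnePoint.coe_ne_infty _))
    refine ⟨L, ?_⟩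
    filter_upwards [hL, he] with w h1 h2
    rw [h2, h1]

/-! ### Compact subgroups of `PGL(2, ℂ)` -/

instance pglIsTopologicalGroup : IsTopologicalGroup PGL(2, ℂ) :=
  inferInstanceAs (IsTopologicalGroup (GL (Fin 2) ℂ ⧸ Subgroup.center (GL (Fin 2) ℂ)))

/-- The Hermitian form `|det g|⁻¹ g gᴴ`. -/
def glForm (g : GL (Fin 2) ℂ) : Matrix (Fin 2) (Fin 2) ℂ :=
  ((‖g.1.det‖⁻¹ : ℝ) : ℂ) • (g.1 * g.1ᴴ)

/-- The determinant scales by `u²`, and `|u|²` cancels against the scaling of `g gᴴ`. Hence the form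
descends to `PGL(2, ℂ)`. -/
theorem glForm_mul_scalar (g : GL (Fin 2) ℂ) (u : ℂˣ) :
    glForm (g * GeneralLinearGroup.scalar (Fin 2) u) = glForm g := by
  have hu : ((‖(u : ℂ)‖ : ℝ) : ℂ) ≠ 0 := by simp
  have hd : ((‖g.1.det‖ : ℝ) : ℂ) ≠ 0 := by
    have := g.det_ne_zero
    simpa using this
  have e : (g * GeneralLinearGroup.scalar (Fin 2) u).1 = (u : ℂ) • g.1 := by
    ext i j
    simp [Matrix.mul_apply, Matrix.diagonal_apply, mul_comm]
  rw [glForm, glForm, e, Matrix.det_smul, conjTranspose_smul, Matrix.smul_mul, Matrix.mul_smul,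
    smul_smul, smul_smul]
  congr 1
  simp only [Fintype.card_fin, norm_mul, norm_pow, Complex.star_def]
  rw [mul_assoc, Complex.mul_conj']
  push_cast
  field_simp

theorem continuous_glForm : Continuous glForm := by
  have h1 : Continuous fun g : GL (Fin 2) ℂ => g.1 := Units.continuous_val
  have h2 : Continuous fun g : GL (Fin 2) ℂ => ‖g.1.det‖⁻¹ :=
    (h1.matrix_det.norm).inv₀ fun g => norm_ne_zero_iff.2 g.det_ne_zero
  exact (Complex.continuous_ofReal.comp h2).smul (h1.matrix_mul h1.matrix_conjTranspose)

/-- The Hermitian form `|det g|⁻¹ g gᴴ` for `g ∈ PGL(2, ℂ)`. -/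
def pglForm (L : PGL(2, ℂ)) : Matrix (Fin 2) (Fin 2) ℂ :=
  Quotient.liftOn' L glForm fun g g' h => by
    obtain ⟨u, rfl⟩ := ProjGenLinGroup.mk_eq_mk_iff.1
      (show ProjGenLinGroup.mk g = ProjGenLinGroup.mk g' from Quotient.sound' h)
    exact (glForm_mul_scalar g u).symm

theorem pglForm_mk (g : GL (Fin 2) ℂ) : pglForm (ProjGenLinGroup.mk g) = glForm g := rfl

theorem continuous_pglForm : Continuous pglForm :=
  continuous_glForm.quotient_liftOn' _

theorem glForm_mul (a g : GL (Fin 2) ℂ) :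
    glForm (a * g) = ((‖a.1.det‖⁻¹ : ℝ) : ℂ) • (a.1 * glForm g * a.1ᴴ) := by
  simp only [glForm, Units.val_mul, Matrix.det_mul, conjTranspose_mul, norm_mul, mul_inv,
    Complex.ofReal_mul, Matrix.mul_smul, Matrix.smul_mul, smul_smul, Matrix.mul_assoc]

theorem pglForm_isHermitian (L : PGL(2, ℂ)) : (pglForm L).IsHermitian := by
  induction L using ProjGenLinGroup.induction_on with | mk g =>
  rw [pglForm_mk, glForm, IsHermitian, conjTranspose_smul, conjTranspose_mul,
    conjTranspose_conjTranspose, Complex.star_def, Complex.conj_ofReal]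

open scoped ComplexOrder in
theorem pglForm_posDef (L : PGL(2, ℂ)) : (pglForm L).PosDef := by
  induction L using ProjGenLinGroup.induction_on with | mk g =>
  rw [pglForm_mk, glForm]
  have hd : (0 : ℂ) < ((‖g.1.det‖⁻¹ : ℝ) : ℂ) := by
    rw [← Complex.ofReal_zero, Complex.real_lt_real]
    exact inv_pos.2 (norm_pos_iff.2 g.det_ne_zero)
  refine PosDef.smul (PosDef.mul_conjTranspose_self _ ?_) hd
  exact Matrix.vecMul_injective_of_isUnit g.isUnit

open scoped ComplexOrder in
/-- A compact group of Möbius transformations preserves a positive definite Hermitian form. -/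
theorem exists_invariant_form (K : Subgroup PGL(2, ℂ))
    (hK : IsCompact (K : Set PGL(2, ℂ))) :
    ∃ H : Matrix (Fin 2) (Fin 2) ℂ, H.PosDef ∧
      ∀ a : GL (Fin 2) ℂ, ProjGenLinGroup.mk a ∈ K → a.1 * H * a.1ᴴ = (‖a.1.det‖ : ℂ) • H := by
  have : CompactSpace K := isCompact_iff_compactSpace.1 hK
  let _ : MeasurableSpace K := borel K
  have : BorelSpace K := ⟨rfl⟩
  let μ : MeasureTheory.Measure K := MeasureTheory.Measure.haar
  have hcont : Continuous fun k : K => pglForm k := continuous_pglForm.comp continuous_subtype_val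
  have hint : ∀ f : K → ℂ, Continuous f → MeasureTheory.Integrable f μ := fun f hf =>
    hf.integrable_of_hasCompactSupport (HasCompactSupport.of_compactSpace f)
  have hentry : ∀ i j, Continuous fun k : K => pglForm k i j := fun i j => hcont.matrix_elem i j
  -- The orbit of the standard form is integrated over `K`. The integral is definite because each
  -- integrand is positive and continuous; it is invariant by left invariance of Haar measure.
  refine ⟨Matrix.of fun i j => ∫ k : K, pglForm k i j ∂μ, ?_, ?_⟩
  · refine PosDef.of_dotProduct_mulVec_pos ?_ ?_
    · ext i j
      simp only [conjTranspose_apply, Matrix.of_apply, Complex.star_def]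
      rw [← integral_conj]
      refine MeasureTheory.integral_congr_ae (Eventually.of_forall fun k => ?_)
      exact (pglForm_isHermitian k).apply i j
    · intro x hx
      set q : K → ℂ := fun k => star x ⬝ᵥ (pglForm k *ᵥ x) with hq
      have e1 : star x ⬝ᵥ ((Matrix.of fun i j => ∫ k : K, pglForm k i j ∂μ) *ᵥ x) =
          ∫ k, q k ∂μ := by
        have hi : ∀ i j, MeasureTheory.Integrable
            (fun k : K => star x i * (pglForm k i j * x j)) μ := fun i j =>
          ((hint _ (hentry i j)).mul_const _).const_mul _
        have hs : ∀ i, MeasureTheory.Integrable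
            (fun k : K => star x i * (pglForm k i 0 * x 0) + star x i * (pglForm k i 1 * x 1)) μ :=
          fun i => (hi i 0).add (hi i 1)
        simp only [hq, dotProduct, mulVec, Fin.sum_univ_two, Matrix.of_apply, mul_add]
        rw [MeasureTheory.integral_add (hs 0) (hs 1),
          MeasureTheory.integral_add (hi 0 0) (hi 0 1),
          MeasureTheory.integral_add (hi 1 0) (hi 1 1)]
        simp only [MeasureTheory.integral_const_mul, MeasureTheory.integral_mul_const]
      have hpos : ∀ k, 0 < q k := fun k => (pglForm_posDef k).dotProduct_mulVec_pos hx
      have hre : ∀ k, q k = ((q k).re : ℂ) := fun k =>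
        Complex.ext rfl ((Complex.lt_def.1 (hpos k)).2.symm)
      have hqc : Continuous q := by
        simp only [hq, dotProduct, mulVec, Fin.sum_univ_two]
        have := hentry
        fun_prop
      rw [e1, show (∫ k, q k ∂μ) = ∫ k, ((q k).re : ℂ) ∂μ from
        MeasureTheory.integral_congr_ae (Eventually.of_forall hre), integral_complex_ofReal,
        ← Complex.ofReal_zero, Complex.real_lt_real]
      exact (Complex.continuous_re.comp hqc).integral_pos_of_hasCompactSupport_nonneg_nonzero
        (HasCompactSupport.of_compactSpace _) (fun k => (Complex.lt_def.1 (hpos k)).1.le)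
        (x := 1) (Complex.lt_def.1 (hpos 1)).1.ne'
  · intro a ha
    have hd : (‖a.1.det‖ : ℂ) ≠ 0 := by
      have := a.det_ne_zero
      simpa using this
    have key : ∀ k : K, (‖a.1.det‖ : ℂ) • pglForm (ProjGenLinGroup.mk a * k) =
        a.1 * pglForm k * a.1ᴴ := by
      intro k
      obtain ⟨g, hg⟩ := ProjGenLinGroup.mk_surjective (k : PGL(2, ℂ))
      rw [← hg, ← map_mul, pglForm_mk, pglForm_mk, glForm_mul, smul_smul]
      push_cast
      rw [mul_inv_cancel₀ hd, one_smul]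
    ext i j
    have hi : ∀ p q, MeasureTheory.Integrable
        (fun k : K => a.1 i p * pglForm k p q * star (a.1 j q)) μ := fun p q =>
      ((hint _ (hentry p q)).const_mul _).mul_const _
    have hs : ∀ q, MeasureTheory.Integrable (fun k : K => a.1 i 0 * pglForm k 0 q * star (a.1 j q) +
        a.1 i 1 * pglForm k 1 q * star (a.1 j q)) μ := fun q => (hi 0 q).add (hi 1 q)
    have e1 : (a.1 * (Matrix.of fun i j => ∫ k : K, pglForm k i j ∂μ) * a.1ᴴ) i j =
        ∫ k : K, (a.1 * pglForm k * a.1ᴴ) i j ∂μ := by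
      simp only [Matrix.mul_apply, Fin.sum_univ_two, Matrix.of_apply, conjTranspose_apply, add_mul]
      rw [MeasureTheory.integral_add (hs 0) (hs 1),
        MeasureTheory.integral_add (hi 0 0) (hi 1 0),
        MeasureTheory.integral_add (hi 0 1) (hi 1 1)]
      simp only [MeasureTheory.integral_const_mul, MeasureTheory.integral_mul_const]
    have e2 := MeasureTheory.integral_mul_left_eq_self (μ := μ)
      (fun k : K => (‖a.1.det‖ : ℂ) * pglForm k i j) ⟨ProjGenLinGroup.mk a, ha⟩
    rw [e1, Matrix.smul_apply, Matrix.of_apply, smul_eq_mul, ← MeasureTheory.integral_const_mul, ← e2]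
    refine MeasureTheory.integral_congr_ae (Eventually.of_forall fun k => ?_)
    exact (congrFun (congrFun (key k) i) j).symm

/-- Dividing by a square root `u` of `det g` gives determinant one, and `|u|² = |det g|` turns the
similitude into a unitary matrix. -/
theorem mk_mem_PSU2 {g : GL (Fin 2) ℂ} (h : g.1 * g.1ᴴ = (‖g.1.det‖ : ℂ) • 1) :
    ProjGenLinGroup.mk g ∈ PSU2 := by
  obtain ⟨u, hu⟩ := IsAlgClosed.exists_pow_nat_eq g.1.det (n := 2) (by norm_num)
  have hd : g.1.det ≠ 0 := g.det_ne_zero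
  have hu0 : u ≠ 0 := by rintro rfl; exact hd (by rw [← hu]; simp)
  refine ⟨g * GeneralLinearGroup.scalar (Fin 2) (Units.mk0 u⁻¹ (inv_ne_zero hu0)), ?_, ?_⟩
  · have e : (g * GeneralLinearGroup.scalar (Fin 2) (Units.mk0 u⁻¹ (inv_ne_zero hu0))).1 = u⁻¹ • g.1 := by
      ext i j
      simp [Matrix.mul_apply, Matrix.diagonal_apply, mul_comm]
    rw [e, mem_specialUnitaryGroup_iff, mem_unitaryGroup_iff]
    constructor
    · rw [star_smul, star_eq_conjTranspose, Matrix.smul_mul, Matrix.mul_smul, h, smul_smul, smul_smul,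
        ← hu, norm_pow, Complex.star_def, map_inv₀]
      have hc : (starRingEnd ℂ) u ≠ 0 := by simpa using hu0
      have h2 : u⁻¹ * ((starRingEnd ℂ) u)⁻¹ * ((‖u‖ ^ 2 : ℝ) : ℂ) = 1 := by
        push_cast
        rw [← Complex.mul_conj']
        field_simp
      rw [h2, one_smul]
    · rw [Matrix.det_smul, ← hu, Fintype.card_fin, ← mul_pow, inv_mul_cancel₀ hu0, one_pow]
  · rw [map_mul, ProjGenLinGroup.mk_scalar, mul_one]

open scoped ComplexOrder in
/-- A compact subgroup of `PGL(2, ℂ)` is conjugate to a subgroup of `PSU(2)`. -/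
theorem exists_conj_subset_PSU2 (K : Subgroup PGL(2, ℂ))
    (hK : IsCompact (K : Set PGL(2, ℂ))) :
    ∃ B : PGL(2, ℂ), ∀ L ∈ K, B * L * B⁻¹ ∈ PSU2 := by
  obtain ⟨H, hH, hinv⟩ := exists_invariant_form K hK
  -- Conjugation by `D⁻¹` carries the invariant form `D Dᴴ` to the standard one.
  obtain ⟨D, hD⟩ : ∃ D : Matrix (Fin 2) (Fin 2) ℂ, H = D * Dᴴ := by
    open scoped MatrixOrder in
    obtain ⟨D, hD⟩ := CStarAlgebra.nonneg_iff_eq_star_mul_self.mp hH.posSemidef.nonneg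
    exact ⟨Dᴴ, by rw [hD, conjTranspose_conjTranspose, star_eq_conjTranspose]⟩
  have hdet : D.det ≠ 0 := by
    intro h
    have := hH.det_pos
    rw [hD, Matrix.det_mul, h, zero_mul] at this
    exact lt_irrefl _ this
  let d : GL (Fin 2) ℂ := GeneralLinearGroup.mkOfDetNeZero D hdet
  have hd : d.1 = D := rfl
  refine ⟨ProjGenLinGroup.mk d⁻¹, fun L hL => ?_⟩
  induction L using ProjGenLinGroup.induction_on with | mk a =>
  rw [← map_inv, inv_inv, ← map_mul, ← map_mul]
  apply mk_mem_PSU2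
  have e1 : (d⁻¹ * a * d).1 = (d⁻¹).1 * a.1 * D := by simp [hd]
  have e2 : (d⁻¹).1 * D = 1 := by rw [← hd, ← Units.val_mul]; simp
  have e3 : Dᴴ * (d⁻¹).1ᴴ = 1 := by rw [← conjTranspose_mul, e2, conjTranspose_one]
  have e4 : (d⁻¹ * a * d).1.det = a.1.det := by
    have : (d⁻¹).1.det * D.det = 1 := by rw [← Matrix.det_mul, e2, Matrix.det_one]
    rw [e1, Matrix.det_mul, Matrix.det_mul]
    linear_combination a.1.det * this
  have h1 := hinv a hL
  rw [hD] at h1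
  rw [e4, e1, conjTranspose_mul, conjTranspose_mul]
  calc (d⁻¹).1 * a.1 * D * (Dᴴ * (a.1ᴴ * (d⁻¹).1ᴴ))
      = (d⁻¹).1 * (a.1 * (D * Dᴴ) * a.1ᴴ) * (d⁻¹).1ᴴ := by simp only [Matrix.mul_assoc]
    _ = (‖a.1.det‖ : ℂ) • (((d⁻¹).1 * D) * (Dᴴ * (d⁻¹).1ᴴ)) := by
        rw [h1, Matrix.mul_smul, Matrix.smul_mul]
        simp only [Matrix.mul_assoc]
    _ = _ := by rw [e2, e3, Matrix.mul_one]

/-- The translation `w ↦ w + b`. -/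
def translationGL (b : ℂ) : GL (Fin 2) ℂ :=
  GeneralLinearGroup.mkOfDetNeZero !![1, b; 0, 1] (by simp)

/-- No nontrivial translation is conjugate to an element of `PSU(2)`. -/
theorem eq_zero_of_conj_translation_mem_PSU2 {M : PGL(2, ℂ)} {b : ℂ}
    (h : M * ProjGenLinGroup.mk (translationGL b) * M⁻¹ ∈ PSU2) : b = 0 := by
  induction M using ProjGenLinGroup.induction_on with | mk m =>
  obtain ⟨g, hg, he⟩ := h
  rw [← map_inv, ← map_mul, ← map_mul, eq_comm, ProjGenLinGroup.mk_eq_mk_iff] at he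
  obtain ⟨u, hu⟩ := he
  obtain ⟨hgu, hgd⟩ := mem_specialUnitaryGroup_iff.1 hg
  have ht : (translationGL b).1 = !![1, b; 0, 1] := rfl
  have e : g.1 = (u : ℂ) • (m.1 * !![1, b; 0, 1] * (m⁻¹).1) := by
    rw [← hu, ← ht]
    ext i j
    simp [Matrix.mul_apply, Matrix.diagonal_apply, mul_comm]
  have hm : m.1 * (m⁻¹).1 = 1 := by rw [← Units.val_mul]; simp
  have hm' : (m⁻¹).1 * m.1 = 1 := by rw [← Units.val_mul]; simp
  have hu2 : (u : ℂ) ^ 2 = 1 := by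
    have hdm : m.1.det * (m⁻¹).1.det = 1 := by rw [← Matrix.det_mul, hm, Matrix.det_one]
    rw [e, Matrix.det_smul, Matrix.det_mul, Matrix.det_mul, Fintype.card_fin,
      Matrix.det_fin_two_of] at hgd
    linear_combination hgd - (u : ℂ) ^ 2 * hdm
  have htr : g.1 0 0 + g.1 1 1 = 2 * u := by
    rw [← Matrix.trace_fin_two, e, Matrix.trace_smul, Matrix.trace_mul_comm, ← Matrix.mul_assoc,
      hm', Matrix.one_mul, Matrix.trace_fin_two_of, smul_eq_mul]
    ring
  have hgu' := (mem_unitaryGroup_iff').1 hgu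
  have e00 := congrFun (congrFun hgu' 0) 0
  have e11 := congrFun (congrFun hgu' 1) 1
  simp [Matrix.mul_apply, Fin.sum_univ_two, star_eq_conjTranspose, Complex.conj_mul'] at e00 e11
  have f00 : ‖g.1 0 0‖ ^ 2 + ‖g.1 1 0‖ ^ 2 = 1 := by exact_mod_cast e00
  have f11 : ‖g.1 0 1‖ ^ 2 + ‖g.1 1 1‖ ^ 2 = 1 := by exact_mod_cast e11
  have hur : ((u : ℂ)).re ^ 2 = 1 ∧ ((u : ℂ)).im = 0 := by
    rcases sq_eq_one_iff.1 hu2 with h | h <;> simp [h]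
  -- This is the squared Hilbert–Schmidt distance from `g` to `u · 1`. As `u = ±1`, the trace is
  -- `2u` and `g` is unitary, it equals `2 - 4 + 2 = 0`.
  have hsum : ‖g.1 0 0 - u‖ ^ 2 + ‖g.1 1 1 - u‖ ^ 2 + ‖g.1 0 1‖ ^ 2 + ‖g.1 1 0‖ ^ 2 = 0 := by
    have hr := congrArg Complex.re htr
    simp only [← Complex.normSq_eq_norm_sq, Complex.normSq_apply, Complex.sub_re,
      Complex.sub_im, Complex.add_re, Complex.mul_re, hur.2] at *
    simp at hr
    linear_combination f00 + f11 - 2 * (u : ℂ).re * hr - 2 * hur.1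
  have z00 : g.1 0 0 = u := by
    rw [← sub_eq_zero, ← norm_eq_zero, ← sq_eq_zero_iff]
    nlinarith [sq_nonneg ‖g.1 0 0 - u‖, sq_nonneg ‖g.1 1 1 - u‖, sq_nonneg ‖g.1 0 1‖,
      sq_nonneg ‖g.1 1 0‖]
  have z11 : g.1 1 1 = u := by linear_combination htr - z00
  have z01 : g.1 0 1 = 0 := by
    rw [← norm_eq_zero, ← sq_eq_zero_iff]
    nlinarith [sq_nonneg ‖g.1 0 0 - u‖, sq_nonneg ‖g.1 1 1 - u‖, sq_nonneg ‖g.1 0 1‖,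
      sq_nonneg ‖g.1 1 0‖]
  have z10 : g.1 1 0 = 0 := by
    rw [← norm_eq_zero, ← sq_eq_zero_iff]
    nlinarith [sq_nonneg ‖g.1 0 0 - u‖, sq_nonneg ‖g.1 1 1 - u‖, sq_nonneg ‖g.1 0 1‖,
      sq_nonneg ‖g.1 1 0‖]
  have hg1 : g.1 = (u : ℂ) • 1 := by
    ext i j
    fin_cases i <;> fin_cases j <;> simp [z00, z11, z01, z10]
  have hfin : !![1, b; 0, 1] = (1 : Matrix (Fin 2) (Fin 2) ℂ) := by
    have h1 : m.1 * !![1, b; 0, 1] * (m⁻¹).1 = 1 :=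
      smul_right_injective _ u.ne_zero (e.symm.trans hg1)
    calc !![1, b; 0, 1] = ((m⁻¹).1 * m.1) * !![1, b; 0, 1] * ((m⁻¹).1 * m.1) := by
          rw [hm', Matrix.one_mul, Matrix.mul_one]
      _ = (m⁻¹).1 * (m.1 * !![1, b; 0, 1] * (m⁻¹).1) * m.1 := by simp only [Matrix.mul_assoc]
      _ = 1 := by rw [h1, Matrix.mul_one, hm']
  simpa using congrFun (congrFun hfin 0) 1

/-! ### Function elements in complex coordinates -/

section Coordinates

variable {X : Type*} [TopologicalSpace X] [ChartedSpace ℂ X]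

theorem analyticAt_transition {e e' : OpenPartialHomeomorph X ℂ}
    (he : e ∈ IsManifold.maximalAtlas 𝓘(ℂ) ω X) (he' : e' ∈ IsManifold.maximalAtlas 𝓘(ℂ) ω X)
    {x : X} (hx : x ∈ e.source) (hx' : x ∈ e'.source) :
    AnalyticAt ℂ (fun z => e' (e.symm z)) (e x) := by
  have h1 := contMDiffAt_symm_of_mem_maximalAtlas he (e.map_source hx)
  have h2 := contMDiffAt_of_mem_maximalAtlas he' hx'
  rw [← e.left_inv hx] at h2
  exact (contMDiffAt_iff_contDiffAt.1 (h2.comp _ h1)).analyticAt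

theorem IsUnivalentAt.sphereHolomorphicAt [IsManifold 𝓘(ℂ) ω X] {h : X → OnePoint ℂ} {x : X}
    (hh : IsUnivalentAt h x) {e : OpenPartialHomeomorph X ℂ}
    (he : e ∈ IsManifold.maximalAtlas 𝓘(ℂ) ω X) (hx : x ∈ e.source) :
    SphereHolomorphicAt (fun z => h (e.symm z)) (e x) := by
  have hτ := analyticAt_transition he (IsManifold.chart_mem_maximalAtlas x) hx
    (mem_chart_source ℂ x)
  have h1 := hh.1
  rw [← e.left_inv hx] at h1
  have h2 : SphereHolomorphicAt (fun z => h ((chartAt ℂ (e.symm (e x))).symm z))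
      ((fun z => chartAt ℂ (e.symm (e x)) (e.symm z)) (e x)) := h1
  rw [e.left_inv hx] at h2
  refine (h2.comp hτ).congr ?_
  have : ∀ᶠ y in 𝓝 x, y ∈ (chartAt ℂ x).source :=
    (chartAt ℂ x).open_source.mem_nhds (mem_chart_source ℂ x)
  filter_upwards [(e.eventually_nhds' _ hx).2 this] with z hz
  rw [(chartAt ℂ x).left_inv hz]

theorem IsUnivalentAt.injOn_comp_symm {h : X → OnePoint ℂ} {x : X}
    (hh : IsUnivalentAt h x) {e : OpenPartialHomeomorph X ℂ} (hx : x ∈ e.source) :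
    ∃ U ∈ 𝓝 (e x), InjOn (fun z => h (e.symm z)) U := by
  obtain ⟨-, U, hU, hinj⟩ := hh
  have h1 : ∀ᶠ z in 𝓝 (e x), e.symm z ∈ U := (e.eventually_nhds' (· ∈ U) hx).2 hU
  have h2 : ∀ᶠ z in 𝓝 (e x), z ∈ e.target := e.open_target.mem_nhds (e.map_source hx)
  exact ⟨_, inter_mem h1 h2, fun a ha b hb hab =>
    e.symm.injOn ha.2 hb.2 (hinj ha.1 hb.1 hab)⟩

theorem neBot_nhdsNE (x : X) : (𝓝[≠] x).NeBot := by
  have hx := mem_chart_source ℂ x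
  rw [neBot_iff]
  intro h
  have h1 : ∀ᶠ y in 𝓝 x, y = x := by
    have : ∀ᶠ y in 𝓝[≠] x, False := by simp [h]
    rw [eventually_nhdsWithin_iff] at this
    filter_upwards [this] with y hy
    by_contra hne
    exact hy hne
  have h2 : ∀ᶠ z in 𝓝 (chartAt ℂ x x), z = chartAt ℂ x x := by
    filter_upwards [((chartAt ℂ x).eventually_nhds' (· = x) hx).2 h1,
      (chartAt ℂ x).open_target.mem_nhds (mem_chart_target ℂ x)] with z hz hz'
    have := (chartAt ℂ x).right_inv hz'
    rw [hz] at this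
    exact this.symm
  have h3 : ∀ᶠ z in 𝓝[≠] (chartAt ℂ x x), False := by
    filter_upwards [nhdsWithin_le_nhds h2, self_mem_nhdsWithin] with z h4 h5 using h5 h4
  exact h3.exists.elim fun _ h => h

end Coordinates

/-! ### Analytic continuation around a regular singularity -/

section Continuation

variable {X : Type*} [TopologicalSpace X] [ChartedSpace ℂ X] {S : Set X}

/-- On the punctured disc of radius `r` in the coordinate `e`, all function elements of `f` are
Möbius equivalent to the branches of a model function. -/
structure IsLocalModel (f : MultivaluedFunction S) (e : OpenPartialHomeomorph X ℂ) (r : ℝ)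
    (W : ℂ → ℂ) (C : ℂ) (α : ℝ) : Prop where
  pos : 0 < r
  ball_subset : Metric.ball 0 r ⊆ e.target
  mem : ∀ z ∈ Metric.ball (0 : ℂ) r, z ≠ 0 → e.symm z ∈ S
  moebius : ∀ z ∈ Metric.ball (0 : ℂ) r, z ≠ 0 → ∀ ℓ, IsLogBranch ℓ z →
    ∀ h, f.IsElement (e.symm z) h →
      ∃ L : PGL(2, ℂ), ∀ᶠ y in 𝓝 (e.symm z), h y = L • (modelFun W C α ℓ (e y) : OnePoint ℂ)

/-- On a small enough punctured disc, elements and model branches have the same Schwarzian at every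
non-pole, so they are Möbius equivalent near each point. One radius serves all branches of the
logarithm. -/
theorem MultivaluedFunction.HasRegularSingularity.exists_isLocalModel [IsManifold 𝓘(ℂ) ω X]
    {f : MultivaluedFunction S} {p : X} (hS : ∀ᶠ x in 𝓝[≠] p, x ∈ S) {α : ℝ} (hα : 0 < α)
    (h : f.HasRegularSingularity p ((1 - α ^ 2) / 2 : ℝ)) :
    ∃ e ∈ IsManifold.maximalAtlas 𝓘(ℂ) ω X, p ∈ e.source ∧ e p = 0 ∧
      ∃ (r : ℝ) (W : ℂ → ℂ) (C : ℂ) (m : ℕ), AnalyticAt ℂ W 0 ∧ W 0 ≠ 0 ∧ (C ≠ 0 → α = m) ∧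
        IsLocalModel f e r W C α := by
  obtain ⟨e, he, hp, hp0, d, ψ, hψ, hs⟩ := h
  obtain ⟨W, C, m, hW, hW0, hC, hmod⟩ := exists_modelFun hα d hψ
  refine ⟨e, he, hp, hp0, ?_⟩
  have h1 : ∀ᶠ z in 𝓝 (0 : ℂ), z ∈ e.target := e.open_target.mem_nhds (hp0 ▸ e.map_source hp)
  have h2 : ∀ᶠ z in 𝓝 (0 : ℂ), z ≠ 0 → e.symm z ∈ S ∧
      ∀ h, f.IsElement (e.symm z) h → h (e.symm z) ≠ OnePoint.infty →
        schwarzian (fun z => affineCoord (h (e.symm z))) (e (e.symm z)) =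
          ((1 - α ^ 2) / 2 : ℝ) / (e (e.symm z)) ^ 2 + d / e (e.symm z) + ψ (e (e.symm z)) := by
    have h3 := (eventually_nhdsWithin_iff.1 (hS.and hs))
    have h4 := (e.eventually_nhds' _ hp).2 h3
    rw [hp0] at h4
    filter_upwards [h4, h1] with z h5 h6 h7
    refine h5 fun h8 => h7 ?_
    rw [← e.right_inv h6, show e.symm z = p from h8, hp0]
  obtain ⟨r, hr, hball⟩ := Metric.eventually_nhds_iff_ball.1
    (h1.and (h2.and (eventually_nhdsWithin_iff.1 hmod)))
  refine ⟨r, W, C, m, hW, hW0, hC, hr, fun z hz => (hball z hz).1,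
    fun z hz hz0 => ((hball z hz).2.1 hz0).1, fun z hz hz0 ℓ hℓ h hh => ?_⟩
  have hzt := (hball z hz).1
  have hzs := e.map_target hzt
  obtain ⟨m1, m2, m3⟩ := (hball z hz).2.2 hz0 ℓ hℓ
  have hu := f.univalent hh
  have hu1 := hu.sphereHolomorphicAt he hzs
  have hu2 := hu.injOn_comp_symm hzs
  have hnear := f.nearby hh
  rw [e.right_inv hzt] at hu1 hu2
  have hnear' : ∀ᶠ w in 𝓝 z, f.IsElement (e.symm w) h := by
    have := (e.eventually_nhds' (fun y => f.IsElement y h) hzs).2 hnear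
    rwa [e.right_inv hzt] at this
  obtain ⟨L, hL⟩ := hu1.exists_moebius hu2 m1 m2 (by
    filter_upwards [m3, hnear', Metric.isOpen_ball.mem_nhds hz, isOpen_ne.mem_nhds hz0]
      with w h3 h4 h5 h6 h7
    have := ((hball w h5).2.1 h6).2 h h4 h7
    rw [e.right_inv (hball w h5).1] at this
    rw [h3, this])
  refine ⟨L, ?_⟩
  have h3 := (e.eventually_nhds (fun w => h (e.symm w) = L • (modelFun W C α ℓ w : OnePoint ℂ))
    hzs).1 (by rwa [e.right_inv hzt])
  filter_upwards [h3, e.open_source.mem_nhds hzs] with y h4 h5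
  rwa [e.left_inv h5] at h4

namespace IsLocalModel

variable {f : MultivaluedFunction S} {e : OpenPartialHomeomorph X ℂ} {r : ℝ} {W : ℂ → ℂ} {C : ℂ}
  {α : ℝ}

theorem exp_mem_ball {ζ : ℂ} (hζ : Real.exp ζ.re < r) : Complex.exp ζ ∈ Metric.ball (0 : ℂ) r := by
  rwa [mem_ball_zero_iff, Complex.norm_exp]

/-- The Möbius transformation relating a function element to a branch of the model is unique. -/
theorem moebius_unique [T2Space X] (hm : IsLocalModel f e r W C α) {z : ℂ}
    (hz : z ∈ Metric.ball (0 : ℂ) r) {ℓ ℓ' : ℂ → ℂ} (hℓ : ℓ =ᶠ[𝓝 z] ℓ')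
    {h h' : X → OnePoint ℂ} (hh : f.IsElement (e.symm z) h)
    (hhh : h =ᶠ[𝓝 (e.symm z)] h') {L L' : PGL(2, ℂ)}
    (e1 : ∀ᶠ y in 𝓝 (e.symm z), h y = L • (modelFun W C α ℓ (e y) : OnePoint ℂ))
    (e2 : ∀ᶠ y in 𝓝 (e.symm z), h' y = L' • (modelFun W C α ℓ' (e y) : OnePoint ℂ)) :
    L = L' := by
  have := neBot_nhdsNE (e.symm z)
  have hzt := hm.ball_subset hz
  have hzs := e.map_target hzt
  obtain ⟨U, hU, hinj⟩ := (f.univalent hh).2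
  have hℓ' : ∀ᶠ y in 𝓝 (e.symm z), ℓ (e y) = ℓ' (e y) :=
    (e.eventually_nhds (fun w => ℓ w = ℓ' w) hzs).1 (by rwa [e.right_inv hzt])
  refine pgl_eq_of_eq_on_nhds (x := e.symm z)
    (u := fun y => (modelFun W C α ℓ (e y) : OnePoint ℂ)) ⟨_, inter_mem hU e1, ?_⟩ ?_
  · rintro x ⟨hx1, hx2⟩ y ⟨hy1, hy2⟩ hxy
    refine hinj hx1 hy1 ?_
    rw [show h x = _ from hx2, show h y = _ from hy2]
    exact congrArg _ hxy
  · filter_upwards [hhh, e1, e2, hℓ'] with y h1 h2 h3 h4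
    rw [← h2, h1, h3, modelFun, modelFun, h4]

/-- Continuation of a function element along the image of a segment under `exp`. -/
theorem exists_continuation [T2Space X] (hm : IsLocalModel f e r W C α) {ζ₀ ζ₁ : ℂ}
    (h₀ : Real.exp ζ₀.re < r) (h₁ : Real.exp ζ₁.re < r) {x y : X}
    (hx : e.symm (Complex.exp ζ₀) = x) (hy : e.symm (Complex.exp ζ₁) = y) {h : X → OnePoint ℂ}
    (hh : f.IsElement x h) {L : PGL(2, ℂ)}
    (hL : ∀ᶠ y in 𝓝 x, h y = L • (modelFun W C α (logBranch ζ₀) (e y) : OnePoint ℂ)) :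
    ∃ (γ : Path x y) (H : unitInterval → X → OnePoint ℂ), (∀ t, γ t ∈ S) ∧ IsContinuation γ H ∧
      (∀ t, f.IsElement (γ t) (H t)) ∧ H 0 =ᶠ[𝓝 x] h ∧
      ∀ᶠ v in 𝓝 y, H 1 v = L • (modelFun W C α (logBranch ζ₁) (e v) : OnePoint ℂ) := by
  -- The half-plane `Re ζ < log r` is convex, so the segment stays in it and its exponential stays
  -- in the punctured disc.
  set ζ : unitInterval → ℂ := fun t => ζ₀ + (t : ℝ) * (ζ₁ - ζ₀) with hζ
  have hζc : Continuous ζ := by fun_prop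
  have hζr : ∀ t, Real.exp (ζ t).re < r := by
    intro t
    have hr := hm.pos
    rw [← Real.lt_log_iff_exp_lt hr] at h₀ h₁ ⊢
    have h2 : (ζ t).re = (1 - (t : ℝ)) * ζ₀.re + t * ζ₁.re := by
      simp [hζ]
      ring
    rw [h2]
    have ht0 := t.2.1
    have ht1 := t.2.2
    rcases ht0.eq_or_lt with h | h
    · rw [← h]; simpa using h₀
    · nlinarith
  have hball : ∀ t, Complex.exp (ζ t) ∈ Metric.ball (0 : ℂ) r := fun t => exp_mem_ball (hζr t)
  have hcont : Continuous fun t => e.symm (Complex.exp (ζ t)) :=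
    e.continuousOn_symm.comp_continuous (Complex.continuous_exp.comp hζc)
      fun t => hm.ball_subset (hball t)
  let γ : Path x y := ⟨⟨_, hcont⟩, by simpa [hζ] using hx, by simpa [hζ] using hy⟩
  have hγ : ∀ t, γ t = e.symm (Complex.exp (ζ t)) := fun t => rfl
  have hγS : ∀ t, γ t ∈ S := fun t => hm.mem _ (hball t) (Complex.exp_ne_zero _)
  obtain ⟨H, hH1, hH2, hH3⟩ := f.continuation γ hγS h hh
  refine ⟨γ, H, hγS, hH1, hH2, hH3, ?_⟩
  have hM : ∀ t, ∃ M : PGL(2, ℂ), ∀ᶠ v in 𝓝 (γ t),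
      H t v = M • (modelFun W C α (logBranch (ζ t)) (e v) : OnePoint ℂ) := fun t =>
    hm.moebius _ (hball t) (Complex.exp_ne_zero _) _ (isLogBranch_logBranch _) _ (hH2 t)
  choose M hM using hM
  -- Nearby elements of the continuation agree, and so do nearby branches of the logarithm.
  -- Uniqueness of the Möbius map makes `M` locally constant, hence constant on the interval.
  have hloc : IsLocallyConstant M := by
    rw [IsLocallyConstant.iff_eventually_eq]
    intro t
    filter_upwards [hH1 t, hζc.continuousAt.eventually (logBranch_eventuallyEq (ζ t)),
      γ.continuous.continuousAt.eventually (hM t).eventually_nhds] with s h1 h2 h3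
    exact hm.moebius_unique (hball s) h2 (hH2 s) h1 (hM s) h3
  have hM0 : M 0 = L := by
    have e0 : ζ 0 = ζ₀ := by simp [hζ]
    have h4 := hH2 0
    have h5 := hM 0
    rw [hγ, e0] at h4 h5
    rw [← hx] at hH3 hL
    refine hm.moebius_unique (exp_mem_ball h₀) (EventuallyEq.refl _ (logBranch ζ₀)) h4 hH3 ?_ hL
    exact h5
  have hM1 : M 1 = L := (hloc.apply_eq_of_preconnectedSpace 1 0).trans hM0
  have h6 := hM 1
  rw [hM1, γ.target, show ζ 1 = ζ₁ by simp [hζ]] at h6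
  exact h6

/-- For integral `α` the factor `exp(-αℓ)` is unchanged by `ℓ ↦ ℓ + 2πi`, so only the logarithmic
term is affected. -/
theorem modelFun_logBranch_add (hC : ∃ m : ℕ, α = m) (ζ z : ℂ) :
    modelFun W C α (logBranch (ζ + 2 * Real.pi * Complex.I)) z =
      modelFun W C α (logBranch ζ) z + 2 * Real.pi * Complex.I * C := by
  obtain ⟨m, hm⟩ := hC
  have e1 : logBranch (ζ + 2 * Real.pi * Complex.I) z =
      logBranch ζ z + 2 * Real.pi * Complex.I := by
    rw [logBranch, logBranch, Complex.exp_periodic ζ]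
    ring
  have e2 : Complex.exp (-(α * (logBranch ζ z + 2 * Real.pi * Complex.I))) =
      Complex.exp (-(α * logBranch ζ z)) := by
    rw [Complex.exp_eq_exp_iff_exists_int]
    refine ⟨-m, ?_⟩
    rw [hm]
    push_cast
    ring
  rw [modelFun, modelFun, e1, e2]
  ring

/-- If the monodromy is conjugate into `PSU(2)`, then the model has no logarithmic term. -/
theorem log_coeff_eq_zero [T2Space X] (hm : IsLocalModel f e r W C α) {m : ℕ}
    (hC : C ≠ 0 → α = m) (hel : ∀ x ∈ S, ∃ h, f.IsElement x h) {B : PGL(2, ℂ)}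
    (hB : ∀ M ∈ f.monodromy, B * M * B⁻¹ ∈ PSU2) : C = 0 := by
  by_contra hC0
  have hr := hm.pos
  set ζ : ℂ := ((Real.log (r / 2) : ℝ) : ℂ) with hζ
  have hζr : Real.exp ζ.re < r := by
    rw [hζ, Complex.ofReal_re, Real.exp_log (by positivity)]
    linarith
  have hζr' : Real.exp (ζ + 2 * Real.pi * Complex.I).re < r := by simpa using hζr
  obtain ⟨h, hh⟩ := hel _ (hm.mem _ (exp_mem_ball hζr) (Complex.exp_ne_zero _))
  obtain ⟨L, hL⟩ := hm.moebius _ (exp_mem_ball hζr) (Complex.exp_ne_zero _) _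
    (isLogBranch_logBranch ζ) h hh
  -- The segment from `ζ` to `ζ + 2πi` covers the circle of radius `r / 2` once.
  obtain ⟨γ, H, h1, h2, h3, h4, h5⟩ := hm.exists_continuation hζr hζr' rfl
    (by rw [Complex.exp_periodic ζ]) hh hL
  have hmem : L * ProjGenLinGroup.mk (translationGL (2 * Real.pi * Complex.I * C)) * L⁻¹ ∈
      f.monodromy := by
    refine ⟨_, γ, H, h1, h2, h3, ?_⟩
    filter_upwards [h4, h5, hL] with y h6 h7 h8
    rw [h6, h7, h8, mul_smul, inv_smul_smul, mul_smul, modelFun_logBranch_add ⟨m, hC hC0⟩,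
      ← sphereMk_one_right (modelFun W C α (logBranch ζ) (e y)), smul_sphereMk _ (by simp)]
    change _ = L • sphereMk (1 * _ + 2 * Real.pi * Complex.I * C * 1) (0 * _ + 1 * 1)
    rw [one_mul, mul_one, zero_mul, mul_one, zero_add, sphereMk_one_right]
  have := hB _ hmem
  rw [show B * (L * ProjGenLinGroup.mk (translationGL (2 * Real.pi * Complex.I * C)) * L⁻¹) * B⁻¹ =
    (B * L) * ProjGenLinGroup.mk (translationGL (2 * Real.pi * Complex.I * C)) * (B * L)⁻¹ by
      group] at this
  have h9 := eq_zero_of_conj_translation_mem_PSU2 this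
  have h10 : (2 * Real.pi * Complex.I : ℂ) ≠ 0 := Complex.two_pi_I_ne_zero
  exact hC0 ((mul_eq_zero.1 h9).resolve_left h10)

end IsLocalModel

end Continuation

/-! ### The normal form at a regular singularity -/

section NormalForm

variable {X : Type*} [TopologicalSpace X] [ChartedSpace ℂ X] {S : Set X}

/-- A coordinate composed with a biholomorphic map of plane domains is a coordinate. -/
theorem trans_mem_maximalAtlas [IsManifold 𝓘(ℂ) ω X] {e : OpenPartialHomeomorph X ℂ}
    (he : e ∈ IsManifold.maximalAtlas 𝓘(ℂ) ω X) {φ : OpenPartialHomeomorph ℂ ℂ}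
    (hφ : ∀ z ∈ φ.source, AnalyticAt ℂ φ z ∧ deriv φ z ≠ 0) :
    e.trans φ ∈ IsManifold.maximalAtlas 𝓘(ℂ) ω X := by
  apply OpenPartialHomeomorph.mem_maximalAtlas_of_contMDiffOn
  · intro x hx
    rw [OpenPartialHomeomorph.trans_source] at hx
    have h1 := contMDiffAt_of_mem_maximalAtlas he hx.1
    have h2 : ContMDiffAt 𝓘(ℂ) 𝓘(ℂ) ω φ (e x) :=
      contMDiffAt_iff_contDiffAt.2 (hφ _ hx.2).1.contDiffAt
    exact (h2.comp x h1).contMDiffWithinAt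
  · intro z hz
    rw [OpenPartialHomeomorph.trans_target] at hz
    have h1 := contMDiffAt_symm_of_mem_maximalAtlas he hz.2
    have h3 := hφ _ (φ.map_target hz.1)
    have h2 : ContMDiffAt 𝓘(ℂ) 𝓘(ℂ) ω φ.symm z :=
      contMDiffAt_iff_contDiffAt.2 (φ.contDiffAt_symm_deriv h3.2 hz.1
        h3.1.differentiableAt.hasDerivAt h3.1.contDiffAt)
    exact (h1.comp z h2).contMDiffWithinAt

/-- A holomorphic function with nonvanishing derivative is locally a coordinate. -/
theorem AnalyticAt.exists_openPartialHomeomorph {k : ℂ → ℂ} {z : ℂ} (hk : AnalyticAt ℂ k z)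
    (hk' : deriv k z ≠ 0) {s : Set ℂ} (hs : s ∈ 𝓝 z) :
    ∃ φ : OpenPartialHomeomorph ℂ ℂ, (∀ w, φ w = k w) ∧ z ∈ φ.source ∧ φ.source ⊆ s ∧
      ∀ w ∈ φ.source, AnalyticAt ℂ φ w ∧ deriv φ w ≠ 0 := by
  have hs' : s ∩ {w | AnalyticAt ℂ k w ∧ deriv k w ≠ 0} ∈ 𝓝 z :=
    inter_mem hs (hk.eventually_analyticAt.and (hk.deriv.continuousAt.eventually_ne hk'))
  have hf : HasFDerivAt k ((ContinuousLinearEquiv.unitsEquivAut ℂ (Units.mk0 _ hk') :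
      ℂ ≃L[ℂ] ℂ) : ℂ →L[ℂ] ℂ) z := by
    have hfd : HasStrictFDerivAt k ((ContinuousLinearEquiv.unitsEquivAut ℂ (Units.mk0 _ hk') :
      ℂ ≃L[ℂ] ℂ) : ℂ →L[ℂ] ℂ) z := hk.hasStrictDerivAt
    exact hfd.hasFDerivAt
  let ρ := hk.contDiffAt.toOpenPartialHomeomorph (n := 1) k hf one_ne_zero
  have hρ : ∀ w, ρ w = k w := fun w => rfl
  have hfun : (ρ : ℂ → ℂ) = k := funext hρ
  refine ⟨ρ.restr (s ∩ {w | AnalyticAt ℂ k w ∧ deriv k w ≠ 0}), hρ, ?_, ?_, ?_⟩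
  · rw [OpenPartialHomeomorph.restr_source]
    exact ⟨ContDiffAt.mem_toOpenPartialHomeomorph_source _ hf one_ne_zero,
      mem_interior_iff_mem_nhds.2 hs'⟩
  · rw [OpenPartialHomeomorph.restr_source]
    exact fun w hw => (interior_subset hw.2).1
  · intro w hw
    rw [OpenPartialHomeomorph.restr_source] at hw
    exact (interior_subset hw.2).2

/-- In the coordinate `ξ = z (W / W(0))^(-1/α)` the model `z^(-α) W` is `W(0) ξ^(-α)`, and `w ↦
W(0)/w` turns it into `ξ^α`. A single `L` suffices for all branches because each is reached by
continuing one fixed element. -/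
theorem IsLocalModel.hasPowerForm [T2Space X] [IsManifold 𝓘(ℂ) ω X] {f : MultivaluedFunction S}
    {e : OpenPartialHomeomorph X ℂ} {r : ℝ} {W : ℂ → ℂ} {α : ℝ} {p : X}
    (hm : IsLocalModel f e r W 0 α) (hα : 0 < α) (he : e ∈ IsManifold.maximalAtlas 𝓘(ℂ) ω X)
    (hp : p ∈ e.source) (hp0 : e p = 0) (hW : AnalyticAt ℂ W 0) (hW0 : W 0 ≠ 0)
    (hel : ∀ x ∈ S, ∃ h, f.IsElement x h) : f.HasPowerForm p α := by
  have hr := hm.pos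
  have hαC : (α : ℂ) ≠ 0 := Complex.ofReal_ne_zero.2 hα.ne'
  -- the new coordinate `z * exp (lam z)`
  set lam : ℂ → ℂ := fun z => -(Complex.log (W z / W 0) / α) with hlam
  have hslit : W 0 / W 0 ∈ Complex.slitPlane := by simp [hW0]
  have hlamz : ∀ z, AnalyticAt ℂ W z → W z / W 0 ∈ Complex.slitPlane → AnalyticAt ℂ lam z :=
    fun z h1 h2 => (h1.div_const.clog h2).div_const.neg
  have hlama := hlamz 0 hW hslit
  have hka : AnalyticAt ℂ (fun z => z * Complex.exp (lam z)) 0 := analyticAt_id.mul hlama.cexp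
  have hkd : deriv (fun z => z * Complex.exp (lam z)) 0 ≠ 0 := by
    have h1 := (hasDerivAt_id' (0 : ℂ)).fun_mul hlama.differentiableAt.hasDerivAt.cexp
    rw [h1.deriv]
    simp [Complex.exp_ne_zero]
  have hgood : ∀ᶠ z in 𝓝 (0 : ℂ), z ∈ Metric.ball (0 : ℂ) r ∧ AnalyticAt ℂ W z ∧
      W z / W 0 ∈ Complex.slitPlane :=
    (show ∀ᶠ z in 𝓝 (0 : ℂ), z ∈ Metric.ball (0 : ℂ) r from Metric.ball_mem_nhds 0 hr).and (hW.eventually_analyticAt.and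
      (hW.div_const.continuousAt.eventually (Complex.isOpen_slitPlane.mem_nhds hslit)))
  obtain ⟨φ, hφk, hφ0, hφs, hφa⟩ := hka.exists_openPartialHomeomorph hkd hgood
  -- the Möbius transformation
  set ζ₀ : ℂ := ((Real.log (r / 2) : ℝ) : ℂ) with hζ
  have hζr : Real.exp ζ₀.re < r := by
    rw [hζ, Complex.ofReal_re, Real.exp_log (by positivity)]
    linarith
  obtain ⟨h₀, hh₀⟩ := hel _ (hm.mem _ (IsLocalModel.exp_mem_ball hζr) (Complex.exp_ne_zero _))
  obtain ⟨L, hL⟩ := hm.moebius _ (IsLocalModel.exp_mem_ball hζr) (Complex.exp_ne_zero _) _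
    (isLogBranch_logBranch ζ₀) h₀ hh₀
  have hdet : (!![0, W 0; 1, 0]).det ≠ 0 := by simp [hW0]
  refine ⟨e.trans φ, trans_mem_maximalAtlas he hφa, ?_, ?_,
    ProjGenLinGroup.mk (GeneralLinearGroup.mkOfDetNeZero _ hdet) * L⁻¹, ?_⟩
  · rw [OpenPartialHomeomorph.trans_source]
    exact ⟨hp, by rw [mem_preimage, hp0]; exact hφ0⟩
  · rw [OpenPartialHomeomorph.trans_apply, hp0, hφk, zero_mul]
  intro x hx hxp ℓ hℓ1 hℓ2
  rw [OpenPartialHomeomorph.trans_source] at hx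
  obtain ⟨hxe, hxφ⟩ := hx
  rw [OpenPartialHomeomorph.trans_apply] at hℓ1 hℓ2
  set z := e x with hz
  obtain ⟨hzb, hWz, hWs⟩ := hφs hxφ
  have hz0 : z ≠ 0 := by
    intro h
    exact hxp (e.injOn hxe hp (by rw [← hz, h, hp0]))
  have hlz := hlamz z hWz hWs
  have hφz := (hφa z hxφ).1
  have hW0z : W z ≠ 0 := by
    intro h
    rw [h, zero_div] at hWs
    exact Complex.zero_notMem_slitPlane hWs
  -- Since `φ(w) = w exp(lam w)`, subtracting `lam` from a logarithm of the new coordinate gives one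
  -- of the old.
  have hℓ' : IsLogBranch (fun w => ℓ (φ w) - lam w) z := by
    refine ⟨(hℓ1.fun_comp hφz).sub hlz, ?_⟩
    filter_upwards [hφz.continuousAt.eventually hℓ2] with w hw
    rw [Complex.exp_sub, hw, hφk]
    field_simp [Complex.exp_ne_zero]
  set ζ₁ := ℓ (φ z) - lam z with hζ₁
  have hexp : Complex.exp ζ₁ = z := hℓ'.2.self_of_nhds
  have hζ₁r : Real.exp ζ₁.re < r := by
    rw [← Complex.norm_exp, hexp]
    exact mem_ball_zero_iff.1 hzb
  have hx' : e.symm (Complex.exp ζ₁) = x := by rw [hexp, hz, e.left_inv hxe]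
  -- The imaginary part of `ζ₁` is arbitrary, so the path may wind around the point as often as the
  -- prescribed branch requires.
  obtain ⟨γ, H, -, -, h3, -, h5⟩ := hm.exists_continuation hζr hζ₁r rfl hx' hh₀ hL
  refine ⟨H 1, by simpa using h3 1, ?_⟩
  have hbr : logBranch ζ₁ =ᶠ[𝓝 z] fun w => ℓ (φ w) - lam w := by
    have h6 := isLogBranch_logBranch ζ₁
    rw [hexp] at h6
    refine h6.eventuallyEq hℓ' ?_
    have := logBranch_apply_exp ζ₁
    rw [hexp] at this
    rw [this]
  have hmodel : ∀ᶠ w in 𝓝 z, modelFun W 0 α (logBranch ζ₁) w =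
      W 0 * Complex.exp (-(α * ℓ (φ w))) := by
    filter_upwards [hbr, hWz.continuousAt.eventually_ne hW0z] with w h7 h8
    rw [modelFun, h7, zero_mul, add_zero, show -((α : ℂ) * (ℓ (φ w) - lam w)) =
      -(α * ℓ (φ w)) + α * lam w by ring, Complex.exp_add,
      show (α : ℂ) * lam w = -Complex.log (W w / W 0) by rw [hlam]; field_simp,
      Complex.exp_neg (Complex.log _), Complex.exp_log (div_ne_zero h8 hW0)]
    field_simp
  have hmodel' := (e.eventually_nhds (fun w => modelFun W 0 α (logBranch ζ₁) w =
      W 0 * Complex.exp (-(α * ℓ (φ w)))) hxe).1 hmodel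
  filter_upwards [h5, hmodel'] with y h9 h10
  rw [h9, mul_smul, inv_smul_smul, h10, ← sphereMk_one_right, smul_sphereMk _ (by simp)]
  change sphereMk (0 * _ + W 0 * 1) (1 * _ + 0 * 1) = _
  rw [← sphereMk_one_right, sphereMk_eq_iff (by simp [hW0]) (by simp),
    OpenPartialHomeomorph.trans_apply]
  simp only [zero_mul, zero_add, mul_one, one_mul, add_zero]
  rw [mul_left_comm, ← Complex.exp_add, add_neg_cancel, Complex.exp_zero, mul_one]

/-- A regular singularity of weight `(1 - α ^ 2) / 2` with monodromy conjugate into `PSU(2)`. -/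
theorem MultivaluedFunction.HasRegularSingularity.hasPowerForm [T2Space X] [IsManifold 𝓘(ℂ) ω X]
    {f : MultivaluedFunction S} {p : X} (hS : ∀ᶠ x in 𝓝[≠] p, x ∈ S) {α : ℝ} (hα : 0 < α)
    (h : f.HasRegularSingularity p ((1 - α ^ 2) / 2 : ℝ))
    (hel : ∀ x ∈ S, ∃ h, f.IsElement x h) {B : PGL(2, ℂ)}
    (hB : ∀ M ∈ f.monodromy, B * M * B⁻¹ ∈ PSU2) : f.HasPowerForm p α := by
  obtain ⟨e, he, hp, hp0, r, W, C, m, hW, hW0, hC, hm⟩ := h.exists_isLocalModel hS hα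
  obtain rfl := hm.log_coeff_eq_zero hC hel hB
  exact hm.hasPowerForm hα he hp hp0 hW hW0 hel

end NormalForm

/-! ### Existence of function elements -/

section Existence

variable {X : Type*} [TopologicalSpace X] [ChartedSpace ℂ X] {S : Set X}

/-- A punctured disc is path connected. -/
theorem isPathConnected_ball_diff_center (c : ℂ) {r : ℝ} (hr : 0 < r) :
    IsPathConnected (Metric.ball c r \ {c}) := by
  -- The punctured disc is the image of this convex half-plane under `ζ ↦ c + exp ζ`.
  have h1 : IsPathConnected {ζ : ℂ | ζ.re < Real.log r} :=
    (convex_halfSpace_re_lt _).isPathConnected ⟨(Real.log r - 1 : ℝ), by simp⟩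
  convert h1.image (f := fun ζ => c + Complex.exp ζ) (by fun_prop) using 1
  ext w
  constructor
  · rintro ⟨h2, h3⟩
    have h4 : w - c ≠ 0 := sub_ne_zero.2 h3
    refine ⟨Complex.log (w - c), ?_, by simp [Complex.exp_log h4]⟩
    rw [mem_ball_iff_norm] at h2
    simpa [Complex.log_re] using Real.log_lt_log (norm_pos_iff.2 h4) h2
  · rintro ⟨ζ, h2, rfl⟩
    refine ⟨?_, by simp [Complex.exp_ne_zero]⟩
    rw [mem_ball_iff_norm, add_sub_cancel_left, Complex.norm_exp]
    exact (Real.lt_log_iff_exp_lt hr).1 h2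

/-- A set omitting only isolated points is locally path connected. -/
theorem exists_nhds_isPathConnected_inter (hS : ∀ x, ∀ᶠ y in 𝓝[≠] x, y ∈ S) (x : X) :
    ∃ V ∈ 𝓝 x, IsPathConnected (V ∩ S) := by
  set e := chartAt ℂ x with he
  have hx : x ∈ e.source := mem_chart_source ℂ x
  have h1 : ∀ᶠ y in 𝓝 x, y ≠ x → y ∈ S := eventually_nhdsWithin_iff.1 (hS x)
  have h2 : ∀ᶠ z in 𝓝 (e x), z ∈ e.target ∧ (e.symm z ≠ x → e.symm z ∈ S) :=
    (show ∀ᶠ z in 𝓝 (e x), z ∈ e.target from e.open_target.mem_nhds (e.map_source hx)).and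
      ((e.eventually_nhds' (fun y => y ≠ x → y ∈ S) hx).2 h1)
  obtain ⟨r, hr, hball⟩ := Metric.eventually_nhds_iff_ball.1 h2
  have hV : e.symm '' Metric.ball (e x) r ∈ 𝓝 x := by
    have := e.symm.image_mem_nhds (e.map_source hx) (Metric.ball_mem_nhds (e x) hr)
    rwa [e.left_inv hx] at this
  refine ⟨_, hV, ?_⟩
  have hne : ∀ z ∈ Metric.ball (e x) r, z ≠ e x → e.symm z ≠ x := by
    intro z hz h3 h4
    apply h3
    rw [← h4, e.right_inv (hball z hz).1]
  have hcont : ContinuousOn e.symm (Metric.ball (e x) r) :=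
    e.continuousOn_symm.mono fun z hz => (hball z hz).1
  by_cases hxS : x ∈ S
  · have h3 : e.symm '' Metric.ball (e x) r ∩ S = e.symm '' Metric.ball (e x) r := by
      rw [inter_eq_left]
      rintro _ ⟨z, hz, rfl⟩
      by_cases h : e.symm z = x
      · rwa [h]
      · exact (hball z hz).2 h
    rw [h3]
    exact ((convex_ball (e x) r).isPathConnected ⟨_, Metric.mem_ball_self hr⟩).image' hcont
  · have h3 : e.symm '' Metric.ball (e x) r ∩ S = e.symm '' (Metric.ball (e x) r \ {e x}) := by
      ext y
      constructor
      · rintro ⟨⟨z, hz, rfl⟩, h4⟩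
        refine ⟨z, ⟨hz, fun h5 => hxS ?_⟩, rfl⟩
        rwa [mem_singleton_iff.1 h5, e.left_inv hx] at h4
      · rintro ⟨z, ⟨hz, h4⟩, rfl⟩
        exact ⟨⟨z, hz, rfl⟩, (hball z hz).2 (hne z hz h4)⟩
    rw [h3]
    exact (isPathConnected_ball_diff_center (e x) hr).image' (hcont.mono sdiff_subset)

/-- A multivalued function on a connected surface minus isolated points has function elements
everywhere. -/
theorem MultivaluedFunction.exists_isElement [ConnectedSpace X]
    (hS : ∀ x, ∀ᶠ y in 𝓝[≠] x, y ∈ S) (f : MultivaluedFunction S) :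
    ∀ x ∈ S, ∃ h, f.IsElement x h := by
  set R : Set X := {x | ∃ h, f.IsElement x h} with hR
  -- Near a point of `G` all points of the domain carry elements, near a point of `B` none do. Both
  -- sets are open, they are disjoint because the domain accumulates everywhere, and continuation in
  -- path connected neighbourhoods shows that they cover `X`.
  set G : Set X := {x | ∀ᶠ y in 𝓝 x, y ∈ S → y ∈ R} with hG
  set B : Set X := {x | ∀ᶠ y in 𝓝 x, y ∈ S → y ∉ R} with hB
  have hGo : IsOpen G := isOpen_setOfPred_eventually_nhds
  have hBo : IsOpen B := isOpen_setOfPred_eventually_nhds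
  have hcover : univ ⊆ G ∪ B := by
    intro x _
    obtain ⟨V, hV, hpc⟩ := exists_nhds_isPathConnected_inter hS x
    by_cases h : ∃ y ∈ V ∩ S, y ∈ R
    · obtain ⟨y, hy, k, hk⟩ := h
      left
      filter_upwards [hV] with w hw hwS
      obtain ⟨γ, hγ⟩ := hpc.joinedIn y hy w ⟨hw, hwS⟩
      obtain ⟨H, -, h2, -⟩ := f.continuation γ (fun t => (hγ t).2) k hk
      exact ⟨H 1, by simpa using h2 1⟩
    · push Not at h
      right
      filter_upwards [hV] with w hw hwS using h w ⟨hw, hwS⟩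
  have hdisj : ∀ x, x ∈ G → x ∈ B → False := by
    intro x h1 h2
    have := neBot_nhdsNE x
    have : ∀ᶠ y in 𝓝[≠] x, False := by
      filter_upwards [nhdsWithin_le_nhds h1, nhdsWithin_le_nhds h2, hS x] with y h3 h4 h5
      exact h4 h5 (h3 h5)
    exact this.exists.elim fun _ h => h
  obtain ⟨x₀, h₀, hh₀⟩ := f.nonempty
  have hx₀ : x₀ ∈ G := by
    rcases hcover (mem_univ x₀) with h | h
    · exact h
    · exact absurd ⟨h₀, hh₀⟩ (h.self_of_nhds (f.mem_domain hh₀))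
  intro x hx
  have hxG : x ∈ G := by
    rcases hcover (mem_univ x) with h | h
    · exact h
    · obtain ⟨y, -, h1, h2⟩ := isPreconnected_univ G B hGo hBo hcover ⟨x₀, mem_univ _, hx₀⟩
        ⟨x, mem_univ _, h⟩
      exact (hdisj y h1 h2).elim
  exact hxG.self_of_nhds hx

end Existence

/-! ### The curvature of the spherical metric -/

section Curvature

/-- The second derivative in a fixed direction, computed along lines. -/
theorem iteratedFDeriv_two_eq_of_hasLineDerivAt {F G : ℂ → ℝ} {z v : ℂ} {c : ℝ}
    (hF : ContDiffAt ℝ 2 F z) (hG : ∀ᶠ w in 𝓝 z, HasLineDerivAt ℝ F (G w) w v)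
    (hc : HasLineDerivAt ℝ G c z v) : iteratedFDeriv ℝ 2 F z ![v, v] = c := by
  have h1 : DifferentiableAt ℝ (fderiv ℝ F) z :=
    (hF.fderiv_right (m := 1) (by norm_num)).differentiableAt (by norm_num)
  have h2 : (fun w => fderiv ℝ F w v) =ᶠ[𝓝 z] G := by
    filter_upwards [hG, hF.eventually (by simp)] with w h3 h4
    rw [← (h4.differentiableAt (by norm_num)).lineDeriv_eq_fderiv, h3.lineDeriv]
  have h5 : DifferentiableAt ℝ G z :=
    (h1.clm_apply (differentiableAt_const v)).congr_of_eventuallyEq h2.symm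
  rw [iteratedFDeriv_two_apply]
  simp only [Matrix.cons_val_zero, Matrix.cons_val_one]
  have h6 : fderiv ℝ (fun w => fderiv ℝ F w v) z = fderiv ℝ G z := h2.fderiv_eq
  rw [fderiv_clm_apply h1 (differentiableAt_const v)] at h6
  have h7 := congrArg (fun T : ℂ →L[ℝ] ℝ => T v) h6
  simp only [fderiv_fun_const, _root_.add_apply, ContinuousLinearMap.comp_apply,
    Pi.zero_apply, _root_.zero_apply, map_zero, zero_add,
    ContinuousLinearMap.flip_apply] at h7
  rw [h7, ← h5.lineDeriv_eq_fderiv, hc.lineDeriv]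

theorem AnalyticAt.hasLineDerivAt {a : ℂ → ℂ} {z : ℂ} (h : AnalyticAt ℂ a z) (v : ℂ) :
    HasLineDerivAt ℝ a (v * deriv a z) z v := by
  have := (h.differentiableAt.hasDerivAt.hasFDerivAt.restrictScalars ℝ).hasLineDerivAt v
  simpa using this

variable {a b : ℂ → ℂ} {z : ℂ}

theorem hasLineDerivAt_log_norm_sq_add (ha : AnalyticAt ℂ a z) (hb : AnalyticAt ℂ b z)
    (h0 : a z ≠ 0 ∨ b z ≠ 0) (v : ℂ) :
    HasLineDerivAt ℝ (fun w => Real.log (‖a w‖ ^ 2 + ‖b w‖ ^ 2))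
      (2 * (inner ℝ (a z) (v * deriv a z) + inner ℝ (b z) (v * deriv b z)) /
        (‖a z‖ ^ 2 + ‖b z‖ ^ 2)) z v := by
  have hN : ‖a z‖ ^ 2 + ‖b z‖ ^ 2 ≠ 0 := by
    rcases h0 with h | h <;> have := norm_pos_iff.2 h <;> positivity
  have h1 : HasDerivAt (fun t : ℝ => a (z + t • v)) (v * deriv a z) 0 := ha.hasLineDerivAt v
  have h2 : HasDerivAt (fun t : ℝ => b (z + t • v)) (v * deriv b z) 0 := hb.hasLineDerivAt v
  have h3 := (h1.norm_sq.add h2.norm_sq).log (by simpa using hN)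
  simp only [zero_smul, add_zero, Pi.add_apply] at h3
  rw [← mul_add] at h3
  exact h3

theorem hasLineDerivAt_inner_mul_deriv (ha : AnalyticAt ℂ a z) (v : ℂ) :
    HasLineDerivAt ℝ (fun w => inner ℝ (a w) (v * deriv a w))
      (inner ℝ (a z) (v * (v * deriv (deriv a) z)) +
        inner ℝ (v * deriv a z) (v * deriv a z)) z v := by
  have h1 : HasDerivAt (fun t : ℝ => a (z + t • v)) (v * deriv a z) 0 := ha.hasLineDerivAt v
  have h2 : HasDerivAt (fun t : ℝ => deriv a (z + t • v)) (v * deriv (deriv a) z) 0 :=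
    ha.deriv.hasLineDerivAt v
  have h3 := h1.inner ℝ (h2.const_mul v)
  simp only [zero_smul, add_zero] at h3
  exact h3

theorem AnalyticAt.contDiffAt_norm_sq {n : WithTop ℕ∞} (ha : AnalyticAt ℂ a z) :
    ContDiffAt ℝ n (fun w => ‖a w‖ ^ 2) z :=
  (ha.contDiffAt (n := n)).restrict_scalars ℝ |>.norm_sq ℝ

theorem contDiffAt_log_norm_sq_add {n : WithTop ℕ∞} (ha : AnalyticAt ℂ a z)
    (hb : AnalyticAt ℂ b z) (h0 : a z ≠ 0 ∨ b z ≠ 0) :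
    ContDiffAt ℝ n (fun w => Real.log (‖a w‖ ^ 2 + ‖b w‖ ^ 2)) z :=
  (ha.contDiffAt_norm_sq.add hb.contDiffAt_norm_sq).log (by
    rcases h0 with h | h <;> have := norm_pos_iff.2 h <;> positivity)

/-- Adding the second derivatives in the directions `1` and `i` cancels `a''` and `b''`, as `i² =
-1`. The rest is Lagrange's identity `(|a|²+|b|²)(|a'|²+|b'|²) - |a'ā + b'b̄|² = |a'b - ab'|²`. -/
theorem laplacian_log_norm_sq_add (ha : AnalyticAt ℂ a z) (hb : AnalyticAt ℂ b z)
    (h0 : a z ≠ 0 ∨ b z ≠ 0) :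
    Laplacian.laplacian (fun w : ℂ => Real.log (‖a w‖ ^ 2 + ‖b w‖ ^ 2)) z =
      (2 * ‖deriv a z * b z - a z * deriv b z‖ / (‖a z‖ ^ 2 + ‖b z‖ ^ 2)) ^ 2 := by
  have hN : ‖a z‖ ^ 2 + ‖b z‖ ^ 2 ≠ 0 := by
    rcases h0 with h | h <;> have := norm_pos_iff.2 h <;> positivity
  have h0' : ∀ᶠ w in 𝓝 z, a w ≠ 0 ∨ b w ≠ 0 := by
    rcases h0 with h | h
    · filter_upwards [ha.continuousAt.eventually_ne h] with w hw using Or.inl hw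
    · filter_upwards [hb.continuousAt.eventually_ne h] with w hw using Or.inr hw
  have hcd : ContDiffAt ℝ 2 (fun w => Real.log (‖a w‖ ^ 2 + ‖b w‖ ^ 2)) z :=
    contDiffAt_log_norm_sq_add ha hb h0
  have key : ∀ v : ℂ, iteratedFDeriv ℝ 2 (fun w => Real.log (‖a w‖ ^ 2 + ‖b w‖ ^ 2)) z ![v, v] =
      (2 * ((inner ℝ (a z) (v * (v * deriv (deriv a) z)) +
          inner ℝ (v * deriv a z) (v * deriv a z)) +
        (inner ℝ (b z) (v * (v * deriv (deriv b) z)) +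
          inner ℝ (v * deriv b z) (v * deriv b z))) * (‖a z‖ ^ 2 + ‖b z‖ ^ 2) -
        2 * (inner ℝ (a z) (v * deriv a z) + inner ℝ (b z) (v * deriv b z)) *
        (2 * inner ℝ (a z) (v * deriv a z) + 2 * inner ℝ (b z) (v * deriv b z))) /
        (‖a z‖ ^ 2 + ‖b z‖ ^ 2) ^ 2 := by
    intro v
    refine iteratedFDeriv_two_eq_of_hasLineDerivAt hcd ?_ (G := fun w =>
      2 * (inner ℝ (a w) (v * deriv a w) + inner ℝ (b w) (v * deriv b w)) /
        (‖a w‖ ^ 2 + ‖b w‖ ^ 2)) ?_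
    · filter_upwards [ha.eventually_analyticAt, hb.eventually_analyticAt, h0'] with w h1 h2 h3
      exact hasLineDerivAt_log_norm_sq_add h1 h2 h3 v
    · have h1 : HasDerivAt (fun t : ℝ => a (z + t • v)) (v * deriv a z) 0 := ha.hasLineDerivAt v
      have h2 : HasDerivAt (fun t : ℝ => b (z + t • v)) (v * deriv b z) 0 := hb.hasLineDerivAt v
      have h3 : HasDerivAt (fun t : ℝ => inner ℝ (a (z + t • v)) (v * deriv a (z + t • v))) _ 0 :=
        hasLineDerivAt_inner_mul_deriv ha v
      have h4 : HasDerivAt (fun t : ℝ => inner ℝ (b (z + t • v)) (v * deriv b (z + t • v))) _ 0 :=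
        hasLineDerivAt_inner_mul_deriv hb v
      have h5 := ((h3.add h4).const_mul 2).div (h1.norm_sq.add h2.norm_sq) (by simpa using hN)
      simp only [zero_smul, add_zero, Pi.add_apply] at h5
      exact h5
  rw [InnerProductSpace.laplacian_eq_iteratedFDeriv_complexPlane]
  beta_reduce
  rw [key, key, ← add_div, div_pow]
  congr 1
  simp only [mul_pow, ← Complex.normSq_eq_norm_sq, Complex.normSq_apply, Complex.inner,
    Complex.mul_re, Complex.mul_im, Complex.conj_re, Complex.conj_im, Complex.sub_re,
    Complex.sub_im, Complex.I_re, Complex.I_im, Complex.one_re, Complex.one_im]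
  ring

end Curvature

/-! ### The pullback of the spherical metric -/

section Pullback

theorem IsLift.sphericalDensity_congr {u v : ℂ → OnePoint ℂ} {a b : ℂ → ℂ} {z : ℂ}
    (h : IsLift u a b z) (hv : ∀ᶠ w in 𝓝 z, v w = u w) :
    sphericalDensity v z = sphericalDensity u z := by
  rw [(h.congr hv).sphericalDensity_eq, h.sphericalDensity_eq]

theorem IsLift.normSq_ne_zero {u : ℂ → OnePoint ℂ} {a b : ℂ → ℂ} {z : ℂ}
    (h : IsLift u a b z) : ‖a z‖ ^ 2 + ‖b z‖ ^ 2 ≠ 0 := by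
  rcases h.ne_zero with h | h <;> have := norm_pos_iff.2 h <;> positivity

/-- The spherical density changes under holomorphic maps like the density of a conformal metric. -/
theorem IsLift.sphericalDensity_comp {u : ℂ → OnePoint ℂ} {a b τ : ℂ → ℂ} {z : ℂ}
    (h : IsLift u a b (τ z)) (hτ : AnalyticAt ℂ τ z) :
    sphericalDensity (fun w => u (τ w)) z = sphericalDensity u (τ z) * ‖deriv τ z‖ := by
  have ha : deriv (fun w => a (τ w)) z = deriv a (τ z) * deriv τ z :=
    (h.left.differentiableAt.hasDerivAt.comp z hτ.differentiableAt.hasDerivAt).deriv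
  have hb : deriv (fun w => b (τ w)) z = deriv b (τ z) * deriv τ z :=
    (h.right.differentiableAt.hasDerivAt.comp z hτ.differentiableAt.hasDerivAt).deriv
  rw [(h.comp hτ).sphericalDensity_eq, h.sphericalDensity_eq, ha, hb,
    show deriv a (τ z) * deriv τ z * b (τ z) - a (τ z) * (deriv b (τ z) * deriv τ z) =
      (deriv a (τ z) * b (τ z) - a (τ z) * deriv b (τ z)) * deriv τ z by ring, norm_mul]
  ring

/-- The spherical metric has curvature `1`. -/
theorem IsLift.laplacian_log_sphericalDensity {u : ℂ → OnePoint ℂ} {a b : ℂ → ℂ} {z : ℂ}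
    (h : IsLift u a b z) (hw : deriv a z * b z - a z * deriv b z ≠ 0) :
    Laplacian.laplacian (fun w : ℂ => Real.log (sphericalDensity u w)) z =
      -(sphericalDensity u z) ^ 2 := by
  set W : ℂ → ℂ := fun w => deriv a w * b w - a w * deriv b w with hW
  have hWa : AnalyticAt ℂ W z := (h.left.deriv.mul h.right).sub (h.left.mul h.right.deriv)
  have hW2 : AnalyticAt ℂ (fun w => 2 * W w) z := analyticAt_const.mul hWa
  -- The logarithm of the numerator is harmonic, so only the denominator contributes to the
  -- curvature.
  have hharm := hW2.harmonicAt_log_norm (by simpa using hw)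
  have heq : (fun w : ℂ => Real.log (sphericalDensity u w)) =ᶠ[𝓝 z]
      (fun w => Real.log ‖2 * W w‖) - fun w => Real.log (‖a w‖ ^ 2 + ‖b w‖ ^ 2) := by
    filter_upwards [h.eventually, hWa.continuousAt.eventually_ne hw] with w h1 h2
    rw [h1.sphericalDensity_eq, Pi.sub_apply, norm_mul, Complex.norm_ofNat]
    exact Real.log_div (mul_ne_zero two_ne_zero (norm_ne_zero_iff.2 h2)) h1.normSq_ne_zero
  rw [(InnerProductSpace.laplacian_congr_nhds heq).self_of_nhds,
    hharm.1.laplacian_sub (contDiffAt_log_norm_sq_add h.left h.right h.ne_zero),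
    hharm.2.self_of_nhds, laplacian_log_norm_sq_add h.left h.right h.ne_zero,
    h.sphericalDensity_eq, Pi.zero_apply, zero_sub]

theorem IsLift.contDiffAt_sphericalDensity {u : ℂ → OnePoint ℂ} {a b : ℂ → ℂ} {z : ℂ}
    (h : IsLift u a b z) (hw : deriv a z * b z - a z * deriv b z ≠ 0) {n : WithTop ℕ∞} :
    ContDiffAt ℝ n (sphericalDensity u) z := by
  have hWa : AnalyticAt ℂ (fun w => deriv a w * b w - a w * deriv b w) z :=
    (h.left.deriv.mul h.right).sub (h.left.mul h.right.deriv)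
  have h1 : ContDiffAt ℝ n (fun w => ‖deriv a w * b w - a w * deriv b w‖) z :=
    ((hWa.contDiffAt (n := n)).restrict_scalars ℝ).norm ℝ hw
  refine ((contDiffAt_const.mul h1).div (h.left.contDiffAt_norm_sq.add
    h.right.contDiffAt_norm_sq) h.normSq_ne_zero).congr_of_eventuallyEq (f := fun w =>
      2 * ‖deriv a w * b w - a w * deriv b w‖ / (‖a w‖ ^ 2 + ‖b w‖ ^ 2)) ?_
  filter_upwards [h.eventually] with w hw using hw.sphericalDensity_eq

variable {X : Type*} [TopologicalSpace X] [ChartedSpace ℂ X] {S : Set X}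

theorem MultivaluedFunction.IsElement.eventually_comp_symm {f : MultivaluedFunction S} {x : X}
    {h : X → OnePoint ℂ} (hh : f.IsElement x h) {e : OpenPartialHomeomorph X ℂ}
    (hx : x ∈ e.source) : ∀ᶠ z in 𝓝 (e x), z ∈ e.target ∧ f.IsElement (e.symm z) h :=
  (show ∀ᶠ z in 𝓝 (e x), z ∈ e.target from e.open_target.mem_nhds (e.map_source hx)).and
    ((e.eventually_nhds' (fun y => f.IsElement y h) hx).2 (f.nearby hh))

variable [IsManifold 𝓘(ℂ) ω X]

theorem MultivaluedFunction.IsElement.exists_isLift {f : MultivaluedFunction S} {x : X}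
    {h : X → OnePoint ℂ} (hh : f.IsElement x h) (L : PGL(2, ℂ)) {e : OpenPartialHomeomorph X ℂ}
    (he : e ∈ IsManifold.maximalAtlas 𝓘(ℂ) ω X) (hx : x ∈ e.source) :
    ∃ a b, IsLift (fun z => L • h (e.symm z)) a b (e x) ∧
      deriv a (e x) * b (e x) - a (e x) * deriv b (e x) ≠ 0 := by
  obtain ⟨a, b, hab⟩ := ((f.univalent hh).sphereHolomorphicAt he hx).exists_isLift
  induction L using ProjGenLinGroup.induction_on with | mk g =>
  refine ⟨_, _, hab.smul g, (hab.smul g).wronskian_ne_zero ?_⟩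
  obtain ⟨U, hU, hinj⟩ := (f.univalent hh).injOn_comp_symm hx
  exact ⟨U, hU, fun y hy w hw hyw => hinj hy hw (MulAction.injective _ hyw)⟩

/-- The pullback of the spherical metric does not depend on the function element. -/
theorem MultivaluedFunction.IsProjective.sphericalDensity_eq {f : MultivaluedFunction S}
    (hf : f.IsProjective) {L : PGL(2, ℂ)} (hL : ∀ M ∈ f.monodromy, L * M * L⁻¹ ∈ PSU2) {x : X}
    {h k : X → OnePoint ℂ} (hh : f.IsElement x h) (hk : f.IsElement x k)
    {e : OpenPartialHomeomorph X ℂ} (he : e ∈ IsManifold.maximalAtlas 𝓘(ℂ) ω X)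
    (hx : x ∈ e.source) :
    sphericalDensity (fun z => L • k (e.symm z)) (e x) =
      sphericalDensity (fun z => L • h (e.symm z)) (e x) := by
  obtain ⟨M, hM⟩ := hf x k h hk hh
  -- Some loop continues `h` to `k = M ∘ h`, so `M` belongs to the monodromy. Then `L ∘ k = (L M
  -- L⁻¹) ∘ (L ∘ h)` differs from `L ∘ h` by an isometry.
  obtain ⟨γ, hγ, H, hH, hHe, hH0, hH1⟩ := f.connected hh hk
  have hMmem : M ∈ f.monodromy := by
    refine ⟨x, γ, H, hγ, hH, hHe, ?_⟩
    filter_upwards [hH0, hH1, hM] with y h1 h2 h3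
    rw [h2, h3, h1]
  obtain ⟨a, b, hab, -⟩ := hh.exists_isLift L he hx
  obtain ⟨a', b', hab', -⟩ := hk.exists_isLift L he hx
  rw [← hab.sphericalDensity_smul_of_mem_PSU2 (hL M hMmem)]
  symm
  apply hab'.sphericalDensity_congr
  filter_upwards [(e.eventually_nhds' (fun y => k y = M • h y) hx).2 hM] with z hz
  rw [hz, mul_smul, mul_smul, inv_smul_smul]

open Classical in
/-- The density of the pullback of the spherical metric under `L ∘ f`. -/
def MultivaluedFunction.pullbackDensity (f : MultivaluedFunction S) (L : PGL(2, ℂ))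
    (e : OpenPartialHomeomorph X ℂ) (z : ℂ) : ℝ :=
  if hz : ∃ h, f.IsElement (e.symm z) h then
    sphericalDensity (fun w => L • hz.choose (e.symm w)) z
  else 1

theorem MultivaluedFunction.IsProjective.pullbackDensity_eq {f : MultivaluedFunction S}
    (hf : f.IsProjective) {L : PGL(2, ℂ)} (hL : ∀ M ∈ f.monodromy, L * M * L⁻¹ ∈ PSU2) {x : X}
    {h : X → OnePoint ℂ} (hh : f.IsElement x h)
    {e : OpenPartialHomeomorph X ℂ} (he : e ∈ IsManifold.maximalAtlas 𝓘(ℂ) ω X)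
    (hx : x ∈ e.source) :
    f.pullbackDensity L e (e x) = sphericalDensity (fun z => L • h (e.symm z)) (e x) := by
  have hex : ∃ h, f.IsElement (e.symm (e x)) h := by
    rw [e.left_inv hx]
    exact ⟨h, hh⟩
  have hc := hex.choose_spec
  rw [pullbackDensity, dif_pos hex]
  generalize hex.choose = k at hc ⊢
  rw [e.left_inv hx] at hc
  exact hf.sphericalDensity_eq hL hh hc he hx

/-- If `L` conjugates the monodromy into `PSU(2)`, then `L ∘ f` pulls the spherical metric back to
a conformal metric. -/
theorem MultivaluedFunction.IsProjective.exists_isPullback {f : MultivaluedFunction S}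
    (hf : f.IsProjective) (hel : ∀ x ∈ S, ∃ h, f.IsElement x h) {L : PGL(2, ℂ)}
    (hL : ∀ M ∈ f.monodromy, L * M * L⁻¹ ∈ PSU2) :
    ∃ g : ConformalMetric S, g.IsPullback f L := by
  refine ⟨⟨f.pullbackDensity L, ?_, ?_, ?_⟩, ?_⟩
  · rintro e he x ⟨hx, hxS⟩
    obtain ⟨h, hh⟩ := hel x hxS
    obtain ⟨a, b, hab, hw⟩ := hh.exists_isLift L he hx
    rw [hf.pullbackDensity_eq hL hh he hx, hab.sphericalDensity_eq]
    have h1 := norm_pos_iff.2 hw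
    have h2 := hab.normSq_ne_zero
    positivity
  · rintro e he _ ⟨x, ⟨hx, hxS⟩, rfl⟩
    obtain ⟨h, hh⟩ := hel x hxS
    obtain ⟨a, b, hab, hw⟩ := hh.exists_isLift L he hx
    -- The chosen element may jump from point to point, but independence of the choice identifies
    -- the density near `x` with that of the single element `h`.
    refine ((hab.contDiffAt_sphericalDensity hw).congr_of_eventuallyEq ?_).contDiffWithinAt
    filter_upwards [hh.eventually_comp_symm hx] with z hz
    have := hf.pullbackDensity_eq hL hz.2 he (e.map_target hz.1)
    rwa [e.right_inv hz.1] at this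
  · rintro e he e' he' x ⟨⟨hx, hx'⟩, hxS⟩
    obtain ⟨h, hh⟩ := hel x hxS
    obtain ⟨a, b, hab, -⟩ := hh.exists_isLift L he' hx'
    obtain ⟨a₁, b₁, hab₁, -⟩ := hh.exists_isLift L he hx
    have hτ := analyticAt_transition he he' hx hx'
    have hτx : (fun z => e' (e.symm z)) (e x) = e' x := by simp [e.left_inv hx]
    rw [← hτx] at hab
    rw [hf.pullbackDensity_eq hL hh he hx, hf.pullbackDensity_eq hL hh he' hx', ← hτx,
      ← hab.sphericalDensity_comp hτ]
    symm
    apply hab₁.sphericalDensity_congr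
    filter_upwards [(e.eventually_nhds' (· ∈ e'.source) hx).2 (e'.open_source.mem_nhds hx')]
      with z hz
    rw [e'.left_inv hz]
  · intro e he x hx h hh
    exact hf.pullbackDensity_eq hL hh he hx

namespace ConformalMetric

variable {g : ConformalMetric S} {f : MultivaluedFunction S} {L : PGL(2, ℂ)}

theorem IsPullback.hasConstantCurvature (hg : g.IsPullback f L)
    (hel : ∀ x ∈ S, ∃ h, f.IsElement x h) : g.HasConstantCurvature 1 := by
  rintro e he x ⟨hx, hxS⟩
  obtain ⟨h, hh⟩ := hel x hxS
  obtain ⟨a, b, hab, hw⟩ := hh.exists_isLift L he hx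
  have heq : (fun z : ℂ => Real.log (g.density e z)) =ᶠ[𝓝 (e x)]
      fun z => Real.log (sphericalDensity (fun z => L • h (e.symm z)) z) := by
    filter_upwards [hh.eventually_comp_symm hx] with z hz
    have := hg e he _ (e.map_target hz.1) h hz.2
    rw [e.right_inv hz.1] at this
    rw [this]
  have hpos := g.density_pos e he x ⟨hx, hxS⟩
  rw [(InnerProductSpace.laplacian_congr_nhds heq).self_of_nhds,
    hab.laplacian_log_sphericalDensity hw, ← hg e he x hx h hh, neg_neg]
  exact div_self (by positivity)

end ConformalMetric

end Pullback

/-! ### Conical singularities -/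

section Conical

variable {X : Type*} [TopologicalSpace X] [ChartedSpace ℂ X] {S : Set X}

/-- If `f` has the form `z ^ α` at `p`, the pullback metric has a conical singularity there. -/
theorem ConformalMetric.IsPullback.hasConicalSingularity {g : ConformalMetric S}
    {f : MultivaluedFunction S} {L : PGL(2, ℂ)} (hg : g.IsPullback f L) {p : X} {α : ℝ} (hα : 0 < α)
    (hp : f.HasPowerForm p α) : g.HasConicalSingularity p α := by
  obtain ⟨e, he, hpe, hp0, L₀, hL₀⟩ := hp
  have hne : ∀ z ∈ e.target, z ≠ 0 → e.symm z ≠ p := by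
    intro z hz h0 h
    apply h0
    rw [← e.right_inv hz, h, hp0]
  have hlog : ∀ z : ℂ, z ≠ 0 → IsLogBranch (logBranch (Complex.log z)) z := by
    intro z hz
    have := isLogBranch_logBranch (Complex.log z)
    rwa [Complex.exp_log hz] at this
  have hbranch : ∀ z ∈ e.target, z ≠ 0 → ∃ h, f.IsElement (e.symm z) h ∧
      ∀ᶠ w in 𝓝 z, L₀ • h (e.symm w) =
        ((Complex.exp (α * logBranch (Complex.log z) w) : ℂ) : OnePoint ℂ) := by
    intro z hz h0
    have hb := hlog z h0
    have hs := e.map_target hz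
    obtain ⟨h, hh, heq⟩ := hL₀ (e.symm z) hs (hne z hz h0) (logBranch (Complex.log z))
      (by rw [e.right_inv hz]; exact hb.1) (by rw [e.right_inv hz]; exact hb.2)
    refine ⟨h, hh, ?_⟩
    have h1 := (e.eventually_nhds' _ hs).2 heq
    rw [e.right_inv hz] at h1
    filter_upwards [h1, e.open_target.mem_nhds hz] with w h2 h3
    rw [h2, e.right_inv h3]
  have hsub : e.source \ {p} ⊆ S := by
    rintro x ⟨hx, hxp⟩
    have h0 : e x ≠ 0 := fun h => hxp (e.injOn hx hpe (by rw [h, hp0]))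
    obtain ⟨h, hh, -⟩ := hbranch (e x) (e.map_source hx) h0
    rw [e.left_inv hx] at hh
    exact f.mem_domain hh
  obtain ⟨m, hm⟩ : ∃ m : GL (Fin 2) ℂ, ProjGenLinGroup.mk m = L * L₀⁻¹ := by
    induction L * L₀⁻¹ using ProjGenLinGroup.induction_on with | mk m => exact ⟨m, rfl⟩
  have hdet := norm_pos_iff.2 (gl_det_ne_zero m)
  set N : ℂ → ℝ := fun t => ‖m 0 0 * t + m 0 1 * 1‖ ^ 2 + ‖m 1 0 * t + m 1 1 * 1‖ ^ 2 with hN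
  have hNpos : ∀ t, N t ≠ 0 := by
    intro t
    rcases gl_apply_ne_zero m (a := t) (b := 1) (by simp) with h | h <;>
      have := norm_pos_iff.2 h <;> simp only [hN] <;> positivity
  -- The Möbius map `m` applied to `z^α` has density `2 |det m| α |z|^(α-1) / N(z^α)`, with `N`
  -- continuous and without zeros.
  have hdens : ∀ z ∈ e.target, z ≠ 0 → Real.log (g.density e z) - (α - 1) * Real.log ‖z‖ =
      Real.log (2 * (‖m 0 0 * m 1 1 - m 0 1 * m 1 0‖ * α)) - Real.log (N (z ^ (α : ℂ))) := by
    intro z hz h0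
    obtain ⟨h, hh, heq⟩ := hbranch z hz h0
    have hb := hlog z h0
    set ℓ := logBranch (Complex.log z) with hℓ
    have hℓz : ℓ z = Complex.log z := by
      have := logBranch_apply_exp (Complex.log z)
      rwa [Complex.exp_log h0] at this
    have hd := (hb.hasDerivAt.const_mul (α : ℂ)).cexp
    have hlift : IsLift (fun w => ((Complex.exp (α * ℓ w) : ℂ) : OnePoint ℂ))
        (fun w => Complex.exp (α * ℓ w)) (fun _ => 1) z :=
      ⟨(analyticAt_const.mul hb.1).cexp, analyticAt_const, by simp,
        Eventually.of_forall fun w => (sphereMk_one_right _).symm⟩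
    have ht : Complex.exp (α * ℓ z) = z ^ (α : ℂ) := by
      rw [hℓz, Complex.cpow_def_of_ne_zero h0, mul_comm]
    have hnorm : ‖z ^ (α : ℂ)‖ = ‖z‖ ^ α := Complex.norm_cpow_real z α
    have hzn := norm_pos_iff.2 h0
    have h1 := hg e he (e.symm z) (e.map_target hz) h hh
    rw [e.right_inv hz] at h1
    have h2 : ∀ᶠ w in 𝓝 z, L • h (e.symm w) =
        ProjGenLinGroup.mk m • ((Complex.exp (α * ℓ w) : ℂ) : OnePoint ℂ) := by
      filter_upwards [heq] with w hw
      rw [hm, ← hw, mul_smul, inv_smul_smul]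
    rw [h1, (hlift.smul m).sphericalDensity_congr h2, hlift.sphericalDensity_smul, hd.deriv, ht]
    simp only [deriv_const, mul_zero, sub_zero, mul_one, norm_mul, norm_div, norm_one, hnorm,
      Complex.norm_real, Real.norm_of_nonneg hα.le]
    have hNz := hNpos (z ^ (α : ℂ))
    simp only [hN, mul_one] at hNz ⊢
    have hzα : ‖z‖ ^ α ≠ 0 := (Real.rpow_pos_of_pos hzn α).ne'
    rw [Real.log_div (by positivity) hNz,
      show 2 * (‖m 0 0 * m 1 1 - m 0 1 * m 1 0‖ * (‖z‖ ^ α * (α * (1 / ‖z‖)))) =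
        (2 * (‖m 0 0 * m 1 1 - m 0 1 * m 1 0‖ * α)) * ‖z‖ ^ α / ‖z‖ by ring,
      Real.log_div (by positivity) hzn.ne', Real.log_mul (by positivity) hzα,
      Real.log_rpow hzn]
    ring
  refine ⟨e, he, hpe, hp0, hsub, fun z => Real.log (2 * (‖m 0 0 * m 1 1 - m 0 1 * m 1 0‖ * α)) -
    Real.log (N (z ^ (α : ℂ))), ?_, hdens⟩
  intro z hz
  refine ContinuousAt.continuousWithinAt ?_
  -- At `0`, the principal power `z^α` is continuous because `α > 0`. Elsewhere it may jump across
  -- the cut, so continuity is taken from the smooth density, which equals the formula.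
  by_cases h0 : z = 0
  · subst h0
    have h1 : ContinuousAt (fun z : ℂ => z ^ (α : ℂ)) 0 :=
      (Complex.continuousAt_cpow_of_re_pos (p := ((0 : ℂ), (α : ℂ))) (by simp) (by simpa)).comp
        (f := fun z : ℂ => (z, (α : ℂ))) (by fun_prop)
    have h2 : Continuous N := by fun_prop
    exact continuousAt_const.sub ((h2.continuousAt.comp h1).log (hNpos _))
  · have hx := e.map_target hz
    have hxS : e.symm z ∈ S := hsub ⟨hx, hne z hz h0⟩
    have hnhds : e '' (e.source ∩ S) ∈ 𝓝 z := by
      filter_upwards [e.open_target.mem_nhds hz, isOpen_ne.mem_nhds h0] with w hw hw0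
      exact ⟨e.symm w, ⟨e.map_target hw, hsub ⟨e.map_target hw, hne w hw hw0⟩⟩, e.right_inv hw⟩
    have hc : ContinuousAt (g.density e) z :=
      (g.contDiffOn_density e he).continuousOn.continuousAt hnhds
    have hpos := g.density_pos e he _ ⟨hx, hxS⟩
    rw [e.right_inv hz] at hpos
    have h3 : ContinuousAt (fun w => Real.log (g.density e w) - (α - 1) * Real.log ‖w‖) z :=
      (hc.log hpos.ne').sub (continuousAt_const.mul
        (continuous_norm.continuousAt.log (norm_ne_zero_iff.2 h0)))
    refine h3.congr ?_
    filter_upwards [e.open_target.mem_nhds hz, isOpen_ne.mem_nhds h0] with w hw hw0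
      using hdens w hw hw0

end Conical

end

/-! ### The exponents, and assembly of the local and global statements -/

theorem lemma1p2 {X : Type*} [TopologicalSpace X] [T2Space X] [CompactSpace X] [ConnectedSpace X]
    [ChartedSpace ℂ X] [IsManifold 𝓘(ℂ) ω X]
    {n : ℕ} (p : Fin n → X) (hp : Function.Injective p)
    (f : MultivaluedFunction (range p)ᶜ) (hf : f.IsProjective)
    (K : Subgroup PGL(2, ℂ))
    (hK : Maximal (fun H : Subgroup PGL(2, ℂ) => IsCompact (H : Set PGL(2, ℂ))) K)
    (hfK : f.monodromy ⊆ (K : Set PGL(2, ℂ)))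
    (c : Fin n → ℝ) (hc : ∀ j, c j ≠ 0 ∧ c j < 1 / 2)
    (hreg : ∀ j, f.HasRegularSingularity (p j) (c j)) :
    ∃ α : Fin n → ℝ,
      (∀ j, 0 < α j ∧ α j ≠ 1 ∧ c j = (1 - α j ^ 2) / 2) ∧
      (∀ j, f.HasPowerForm (p j) (α j)) ∧
      (∃ (L : PGL(2, ℂ)) (g : ConformalMetric (range p)ᶜ),
        g.IsPullback f L ∧ g.HasConstantCurvature 1 ∧ g.RepresentsDivisor p α) ∧
      (f.monodromy ⊆ PSU2 →
        ∃ g : ConformalMetric (range p)ᶜ,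
          g.IsPullback f 1 ∧ g.HasConstantCurvature 1 ∧ g.RepresentsDivisor p α) := by
  have hS : ∀ x, ∀ᶠ y in 𝓝[≠] x, y ∈ (range p)ᶜ := by
    intro x
    have h1 : IsOpen (range p \ {x})ᶜ := ((finite_range p).sdiff).isClosed.isOpen_compl
    filter_upwards [nhdsWithin_le_nhds (h1.mem_nhds fun h => h.2 rfl), self_mem_nhdsWithin]
      with y h2 h3 h4 using h2 ⟨h4, h3⟩
  have hel := f.exists_isElement hS
  obtain ⟨B, hB⟩ := exists_conj_subset_PSU2 K hK.1
  replace hB : ∀ M ∈ f.monodromy, B * M * B⁻¹ ∈ PSU2 := fun M hM => hB M (hfK hM)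
  -- The positive root of `c = (1 - α²)/2`: it is real and nonzero because `c < 1/2`, and different
  -- from `1` because `c ≠ 0`.
  set α : Fin n → ℝ := fun j => √(1 - 2 * c j) with hα
  have hsq : ∀ j, α j ^ 2 = 1 - 2 * c j := fun j => Real.sq_sqrt (by linarith [(hc j).2])
  have hpos : ∀ j, 0 < α j := fun j => Real.sqrt_pos.2 (by linarith [(hc j).2])
  have hcα : ∀ j, c j = (1 - α j ^ 2) / 2 := fun j => by rw [hsq]; ring
  have hpow : ∀ j, f.HasPowerForm (p j) (α j) := by
    intro j
    have h := hreg j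
    rw [hcα j] at h
    exact h.hasPowerForm (hS (p j)) (hpos j) hel hB
  have hmetric : ∀ L : PGL(2, ℂ), (∀ M ∈ f.monodromy, L * M * L⁻¹ ∈ PSU2) →
      ∃ g : ConformalMetric (range p)ᶜ,
        g.IsPullback f L ∧ g.HasConstantCurvature 1 ∧ g.RepresentsDivisor p α := by
    intro L hL
    obtain ⟨g, hg⟩ := hf.exists_isPullback hel hL
    exact ⟨g, hg, hg.hasConstantCurvature hel,
      fun j => hg.hasConicalSingularity (hpos j) (hpow j)⟩
  refine ⟨α, fun j => ⟨hpos j, fun h => (hc j).1 ?_, hcα j⟩, hpow, ⟨B, hmetric B hB⟩, fun hU => ?_⟩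
  · rw [hcα j, h]
    norm_num
  · exact hmetric 1 fun M hM => by simpa using hU hM
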